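/- **Setting.** A MWMR register $\mathbf R$ with values in a set $V$ having at least two elements and with initial value $v_0$ is shared by $n\ge 3$ asynchronous processes $p_1,\dots,p_n$, which may crash; each of them may read and write $\mathbf R$. Consider the following implementation of $\mathbf R$ from atomic single-writer registers $Val[1],\dots,Val[n]$ (all processes read $Val[i]$, only $p_i$ writes it). $Val[i]$ contains a pair $(v,ts)$ of a value and a vector timestamp of length $n$, initially $(v_0,[0,\dots,0])$. Each process has a local array $new\_ts$ of length $n$, initially $[\infty,\dots,\infty]$. - *Write of $v$ by $p_k$:* for $i=1,\dots,n$ in this order, $p_k$ reads $Val[i]$ and sets $new\_ts[i]\leftarrow (Val[i].ts)[i]$ if $i\neq k$, and $new\_ts[i]\leftarrow (Val[i].ts)[i]+1$ if $i=k$; then it writes $(v,new\_ts)$ to $Val[k]$, resets $new\_ts$ to $[\infty,\dots,\infty]$, and returns *done*. - *Read by a process:* for $i=1,\dots,n$ in this order, it reads $(v_i,ts_i)$ from $Val[i]$; then it returns $v_j$ (the value in the pair $(v_j,ts_j)$) for some $j$ such that $ts_j$ is the lexicographic maximum of $ts_1,\dots,ts_n$. A history is a finite sequence of invocations and responses of operations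 on $\mathbf R$ and of atomic accesses to the registers $Val[i]$. Let $\mathcal H_n$ be the set of histories of this algorithm. **Definitions.** A *linearization function* for a set $\mathcal H$ of histories maps each $H\in\mathcal H$ to a sequential history $f(H)$ such that: (1) $f(H)$ contains all operations that are complete in $H$, with the responses they have in $H$, and possibly some operations that are pending in $H$, with matching responses added (and no other operations, each at most once); (2) if $o$ and $o'$ are in $f(H)$ and the response of $o$ occurs before the invocation of $o'$ in $H$, then $o$ occurs before $o'$ in $f(H)$; (3) every read in $f(H)$ returns the value written by the last write that occurs before it in $f(H)$, or $v_0$ if there is none. It is a *strong linearization function* if moreover, for all $G,H\in\mathcal H$ such that $G$ is a prefix of $H$, $f(G)$ is a prefix of $f(H)$. It is a *write strong-linearization function* if instead, for all such $G,H$, the sequence of write operations in $f(G)$ is a prefix of the sequence of write operations in $f(H)$. The set $\mathcal H$ (or an algorithm whose set of histories is $\mathcal H$) is *strongly linearizable*, respectively *write strongly-linearizable*, if it has a strong linearization function, respectively a write strong-linearization function. **Claim.** For every $n\ge 3$, the algorithm above is not a strongly linearizable implementation of a MWMR register: $\mathcal H_n$ has no strong linearization function. Moreover, strong linearizability is strictly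 stronger than write strong-linearizability: every strongly linearizable set of histories is write strongly-linearizable, whereas $\mathcal H_n$ is write strongly-linearizable but not strongly linearizable. -/

import Mathlib

namespace RegisterLin

/-- The operations of a read/write register with values in `V`. -/
inductive RegOp (V : Type*) where
  | read : RegOp V
  | write (v : V) : RegOp V

/-- The responses of a register: a read returns a value, a write returns `done`. -/
inductive RegResp (V : Type*) where
  | val (v : V) : RegResp V
  | done : RegResp V

/-- Vector timestamps of length `n`; an entry that is not computed yet is `∞ = ⊤`. -/
abbrev Stamp (n : ℕ) := Fin n → ℕ∞

/-- Contents `(v, ts)` of a shared register `Val[i]`. -/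
abbrev Cell (n : ℕ) (V : Type*) := V × Stamp n

/-- The events of a history of an implementation of a register by `n` processes from shared
registers `Val[i]`, where `Val[p]` is written by process `p` only: invocations and responses
of operations on the implemented register, and atomic accesses to the shared registers. -/
inductive Event (n : ℕ) (V : Type*) where
  /-- process `p` invokes operation `o` on the implemented register -/
  | inv (p : Fin n) (o : RegOp V) : Event n V
  /-- process `p` reads `c` from `Val[i]` -/
  | baseRead (p i : Fin n) (c : Cell n V) : Event n V
  /-- process `p` writes `c` to `Val[p]` -/
  | baseWrite (p : Fin n) (c : Cell n V) : Event n V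
  /-- the operation that `p` is executing returns `r` -/
  | resp (p : Fin n) (r : RegResp V) : Event n V

/-- A (finite) history. -/
abbrev History (n : ℕ) (V : Type*) := List (Event n V)

/-! ### Operations in a history

An operation of a history `H` is identified with the position `k` of its invocation in `H`. -/

/-- In `H`, the operation invoked at position `k` has its response at position `m`, with value
`r`: this is the first response of the same process after position `k`. -/
def RespondsAt {n : ℕ} {V : Type*} (H : History n V) (k m : ℕ) (r : RegResp V) : Prop :=
  ∃ (p : Fin n) (o : RegOp V), H[k]? = some (Event.inv p o) ∧ k < m ∧
    H[m]? = some (Event.resp p r) ∧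
    ∀ j, k < j → j < m → ∀ r', H[j]? ≠ some (Event.resp p r')

/-- The operation invoked at position `k` is complete in `H`. -/
def CompleteIn {n : ℕ} {V : Type*} (H : History n V) (k : ℕ) : Prop :=
  ∃ m r, RespondsAt H k m r

/-- The operation invoked at `k` precedes the one invoked at `k'`: the response of the former
occurs before the invocation of the latter. -/
def Precedes {n : ℕ} {V : Type*} (H : History n V) (k k' : ℕ) : Prop :=
  ∃ m r, RespondsAt H k m r ∧ m < k'

/-! ### Sequential histories and linearization functions -/

/-- An operation with its matching response, as it occurs in a sequential history: a read by
`p` that returns `v`, or a write of `v` by `p` (which returns `done`).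
The number `id` identifies the operation. -/
inductive SeqOp (n : ℕ) (V : Type*) where
  | read (p : Fin n) (id : ℕ) (v : V) : SeqOp n V
  | write (p : Fin n) (id : ℕ) (v : V) : SeqOp n V

namespace SeqOp

variable {n : ℕ} {V : Type*}

/-- The process that executes the operation. -/
def proc : SeqOp n V → Fin n
  | read p _ _ => p
  | write p _ _ => p

/-- The identity of the operation. -/
def ident : SeqOp n V → ℕ
  | read _ k _ => k
  | write _ k _ => k

/-- The operation without its response. -/
def op : SeqOp n V → RegOp V
  | read _ _ _ => RegOp.read
  | write _ _ v => RegOp.write v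

/-- The response of the operation. -/
def resp : SeqOp n V → RegResp V
  | read _ _ v => RegResp.val v
  | write _ _ _ => RegResp.done

/-- Is the operation a write? -/
def isWrite : SeqOp n V → Bool
  | read _ _ _ => false
  | write _ _ _ => true

end SeqOp

/-- A sequential history: a sequence of operations, each with its response. -/
abbrev SeqHistory (n : ℕ) (V : Type*) := List (SeqOp n V)

/-- The value written by the last write in the sequential history `S`, and the initial value
`v₀` if there is no write in `S`. -/
def lastValue {n : ℕ} {V : Type*} (v₀ : V) (S : SeqHistory n V) : V :=
  S.foldl (fun cur e => match e with
    | SeqOp.read _ _ _ => cur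
    | SeqOp.write _ _ v => v) v₀

/-- `S` is a linearization of `H` with respect to the type register with initial value `v₀`. -/
structure IsLinearization {n : ℕ} {V : Type*} (v₀ : V) (H : History n V)
    (S : SeqHistory n V) : Prop where
  /-- no operation occurs twice in `S` -/
  nodup : (S.map SeqOp.ident).Nodup
  /-- every operation in `S` is an operation of `H` -/
  invoked : ∀ e ∈ S, H[e.ident]? = some (Event.inv e.proc e.op)
  /-- an operation that is complete in `H` has in `S` the response that it has in `H` -/
  response : ∀ e ∈ S, ∀ m r, RespondsAt H e.ident m r → e.resp = r
  /-- `S` contains all the operations that are complete in `H` -/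
  complete : ∀ k, CompleteIn H k → ∃ e ∈ S, e.ident = k
  /-- `S` respects the precedence order of `H` -/
  order : ∀ (i j : ℕ) (hi : i < S.length) (hj : j < S.length),
    Precedes H S[i].ident S[j].ident → i < j
  /-- every read in `S` returns the value of the last write that occurs before it in `S`, or the
  initial value if there is none -/
  reads : ∀ (i p k v), S[i]? = some (SeqOp.read p k v) → v = lastValue v₀ (S.take i)

/-- `f` is a linearization function for the set of histories `ℋ`. -/
def IsLinearizationFunction {n : ℕ} {V : Type*} (v₀ : V) (ℋ : Set (History n V))
    (f : History n V → SeqHistory n V) : Prop :=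
  ∀ H ∈ ℋ, IsLinearization v₀ H (f H)

/-- `f` is a strong linearization function for `ℋ`: if `G` is a prefix of `H`, then
`f G` is a prefix of `f H`. -/
def IsStrongLinearizationFunction {n : ℕ} {V : Type*} (v₀ : V) (ℋ : Set (History n V))
    (f : History n V → SeqHistory n V) : Prop :=
  IsLinearizationFunction v₀ ℋ f ∧
    ∀ G ∈ ℋ, ∀ H ∈ ℋ, G <+: H → f G <+: f H

/-- `f` is a write strong-linearization function for `ℋ`: if `G` is a prefix of `H`, then
the sequence of writes in `f G` is a prefix of the sequence of writes in `f H`. -/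
def IsWriteStrongLinearizationFunction {n : ℕ} {V : Type*} (v₀ : V) (ℋ : Set (History n V))
    (f : History n V → SeqHistory n V) : Prop :=
  IsLinearizationFunction v₀ ℋ f ∧
    ∀ G ∈ ℋ, ∀ H ∈ ℋ, G <+: H →
      (f G).filter SeqOp.isWrite <+: (f H).filter SeqOp.isWrite

/-- An algorithm with set of histories `ℋ` is a strongly linearizable implementation of a
register with initial value `v₀`. -/
def StronglyLinearizable {n : ℕ} {V : Type*} (v₀ : V) (ℋ : Set (History n V)) : Prop :=
  ∃ f, IsStrongLinearizationFunction v₀ ℋ f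

/-- An algorithm with set of histories `ℋ` is a write strongly-linearizable implementation of a
register with initial value `v₀`. -/
def WriteStronglyLinearizable {n : ℕ} {V : Type*} (v₀ : V) (ℋ : Set (History n V)) : Prop :=
  ∃ f, IsWriteStrongLinearizationFunction v₀ ℋ f

/-! ### The vector-clock implementation of a MWMR register from atomic SWMR registers -/

namespace VectorClock

/-- The control state of a process. The array `new_ts` equals `[∞, …, ∞]` whenever the process
is not executing a write, so it is recorded during the execution of a write only. -/
inductive Local (n : ℕ) (V : Type*) where
  /-- no operation is being executed -/
  | idle : Local n V
  /-- executing a write of `v`; the first `i` iterations of the loop are done -/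
  | writing (v : V) (i : ℕ) (newTs : Stamp n) : Local n V
  /-- executing a write that has already written to `Val[-]` -/
  | written : Local n V
  /-- executing a read; `cs` is the list of tuples read so far, from `Val[1], Val[2], …` -/
  | reading (cs : List (Cell n V)) : Local n V

/-- A configuration: the contents of the shared registers and the states of the processes. -/
structure Config (n : ℕ) (V : Type*) where
  val : Fin n → Cell n V
  loc : Fin n → Local n V

/-- Initially every `Val[i]` contains `(v₀, [0, …, 0])` and no operation is being executed. -/
def Config.init (n : ℕ) {V : Type*} (v₀ : V) : Config n V where
  val := fun _ => (v₀, fun _ => 0)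
  loc := fun _ => Local.idle

/-- The configuration after process `p` moves to the control state `l`. -/
def Config.setLoc {n : ℕ} {V : Type*} (s : Config n V) (p : Fin n) (l : Local n V) :
    Config n V where
  val := s.val
  loc := Function.update s.loc p l

/-- The configuration after `c` is written to `Val[p]`. -/
def Config.setVal {n : ℕ} {V : Type*} (s : Config n V) (p : Fin n) (c : Cell n V) :
    Config n V where
  val := Function.update s.val p c
  loc := s.loc

/-- `Step s e s'`: in configuration `s` the algorithm can perform the event `e`, which leads to
configuration `s'`. -/
inductive Step {n : ℕ} {V : Type*} : Config n V → Event n V → Config n V → Prop where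
  /-- an idle process starts a write, with `new_ts = [∞, …, ∞]` -/
  | invWrite (s : Config n V) (p : Fin n) (v : V) (h : s.loc p = Local.idle) :
      Step s (Event.inv p (RegOp.write v))
        (s.setLoc p (Local.writing v 0 (fun _ => ⊤)))
  /-- next iteration of the loop of a write: `new_ts[i] ← (Val[i].ts)[i]` if `i ≠ p`, and
  `new_ts[i] ← (Val[i].ts)[i] + 1` if `i = p` -/
  | writeScan (s : Config n V) (p : Fin n) (v : V) (i : Fin n) (ts : Stamp n)
      (h : s.loc p = Local.writing v i ts) :
      Step s (Event.baseRead p i (s.val i))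
        (s.setLoc p (Local.writing v (i + 1)
          (Function.update ts i (if i = p then (s.val i).2 i + 1 else (s.val i).2 i))))
  /-- the loop is finished: `Val[p] ← (v, new_ts)` -/
  | writeStore (s : Config n V) (p : Fin n) (v : V) (ts : Stamp n)
      (h : s.loc p = Local.writing v n ts) :
      Step s (Event.baseWrite p (v, ts)) ((s.setVal p (v, ts)).setLoc p Local.written)
  /-- the write resets `new_ts` and returns `done` -/
  | writeReturn (s : Config n V) (p : Fin n) (h : s.loc p = Local.written) :
      Step s (Event.resp p RegResp.done) (s.setLoc p Local.idle)
  /-- an idle process starts a read -/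
  | invRead (s : Config n V) (p : Fin n) (h : s.loc p = Local.idle) :
      Step s (Event.inv p RegOp.read) (s.setLoc p (Local.reading []))
  /-- next iteration of the loop of a read: `(v_i, ts_i) ← Val[i]` -/
  | readScan (s : Config n V) (p : Fin n) (i : Fin n) (cs : List (Cell n V))
      (h : s.loc p = Local.reading cs) (hi : cs.length = i) :
      Step s (Event.baseRead p i (s.val i))
        (s.setLoc p (Local.reading (cs ++ [s.val i])))
  /-- the loop is finished: the read returns the value of a collected tuple whose timestamp is the
  greatest one in the lexicographic order -/
  | readReturn (s : Config n V) (p : Fin n) (cs : List (Cell n V)) (c : Cell n V)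
      (h : s.loc p = Local.reading cs) (hlen : cs.length = n) (hc : c ∈ cs)
      (hmax : ∀ c' ∈ cs, toLex c'.2 ≤ toLex c.2) :
      Step s (Event.resp p (RegResp.val c.1)) (s.setLoc p Local.idle)

/-- `Run v₀ H s`: from the initial configuration, the algorithm can perform the sequence of
events `H`, which leads to configuration `s`. -/
inductive Run {n : ℕ} {V : Type*} (v₀ : V) : History n V → Config n V → Prop where
  | nil : Run v₀ [] (Config.init n v₀)
  | snoc {H : History n V} {s s' : Config n V} {e : Event n V} :
      Run v₀ H s → Step s e s' → Run v₀ (H ++ [e]) s'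

/-- The set of histories of the algorithm, executed by `n` processes, for a register with
values in `V` and initial value `v₀`. -/
def histories (n : ℕ) {V : Type*} (v₀ : V) : Set (History n V) :=
  {H | ∃ s, Run v₀ H s}

end VectorClock

end RegisterLin

/-!
Write strong-linearizability. The linearization is built along the history as a list of blocks, one
for each committed write, where a block also holds the completed reads that return the value of its
write. When a write that is not committed yet stores its tuple, it is committed, and just before it
all active uncommitted writes whose partial timestamps (with `∞` in the entries not computed yet)
are lexicographically smaller. A partial timestamp only decreases while it is being computed, but it
never falls to the timestamp of an already committed write. So every tuple in a register belongs to
a committed write, a write that stores last always has the greatest timestamp in the list, and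
committed writes never move. A read that returns is inserted at the end of the block of the tuple it
returns.

Failure of strong linearizability. Let `p₃` start a read and collect only `Val[1]`, and then let
`p₁` complete a write of `v ≠ v₀`. If the read now finishes alone, it returns `v₀`, hence is
linearized before the completed write, and a strong linearization function must have placed it there
already. If instead `p₂` first completes a write of `v`, then the read returns `v`.
-/

namespace RegisterLin

section Histories

variable {n : ℕ} {V : Type*} {H : History n V} {p : Fin n} {o : RegOp V} {r : RegResp V}
  {e : Event n V} {k m : ℕ}

theorem getElem?_snoc_eq_some_iff {α : Type*} {l : List α} {a x : α} {k : ℕ} :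
    (l ++ [a])[k]? = some x ↔ l[k]? = some x ∨ k = l.length ∧ a = x := by
  grind

/-- The operation `o` that `p` invokes at position `k` of `H` is pending. -/
structure Pending (H : History n V) (p : Fin n) (k : ℕ) (o : RegOp V) : Prop where
  invoked : H[k]? = some (Event.inv p o)
  not_resp : ∀ m, k < m → ∀ r, H[m]? ≠ some (Event.resp p r)

theorem RespondsAt.lt_length (h : RespondsAt H k m r) : m < H.length := by
  obtain ⟨_, _, -, -, hm, -⟩ := h
  exact (List.getElem?_eq_some_iff.1 hm).1

theorem respondsAt_snoc_iff : RespondsAt (H ++ [e]) k m r ↔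
    RespondsAt H k m r ∨ m = H.length ∧ ∃ p o, e = Event.resp p r ∧ Pending H p k o := by
  constructor
  · intro h
    have hm : m < H.length + 1 := by simpa using h.lt_length
    obtain ⟨p, o, hk, hkm, hr, hj⟩ := h
    have hk' : H[k]? = some (Event.inv p o) :=
      (getElem?_snoc_eq_some_iff.1 hk).resolve_right fun h => by omega
    have hj' : ∀ j, k < j → j < m → ∀ r', H[j]? ≠ some (Event.resp p r') := fun j hkj hjm r' h =>
      hj j hkj hjm r' (getElem?_snoc_eq_some_iff.2 (Or.inl h))
    rcases getElem?_snoc_eq_some_iff.1 hr with hr | ⟨rfl, rfl⟩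
    · exact Or.inl ⟨p, o, hk', hkm, hr, hj'⟩
    · refine Or.inr ⟨rfl, p, o, rfl, hk', fun j hkj r' h => ?_⟩
      exact hj' j hkj (List.getElem?_eq_some_iff.1 h).1 r' h
  · rintro (h | ⟨rfl, p, o, rfl, hk, hr⟩)
    · have hm := h.lt_length
      obtain ⟨p, o, hk, hkm, hr, hj⟩ := h
      exact ⟨p, o, by grind, hkm, by grind, by grind⟩
    · exact ⟨p, o, by grind, by grind, by grind, by grind⟩

theorem CompleteIn.snoc (h : CompleteIn H k) (e : Event n V) : CompleteIn (H ++ [e]) k := by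
  obtain ⟨m, r, h⟩ := h
  exact ⟨m, r, respondsAt_snoc_iff.2 (Or.inl h)⟩

theorem completeIn_snoc_iff_of_forall_ne_resp (he : ∀ p r, e ≠ Event.resp p r) :
    CompleteIn (H ++ [e]) k ↔ CompleteIn H k := by
  simp [CompleteIn, respondsAt_snoc_iff, he]

theorem precedes_snoc_iff {k' : ℕ} (hk' : k' ≤ H.length) :
    Precedes (H ++ [e]) k k' ↔ Precedes H k k' := by
  refine exists₂_congr fun m r => ⟨fun ⟨h, hm⟩ => ⟨?_, hm⟩, fun ⟨h, hm⟩ => ⟨?_, hm⟩⟩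
  · exact (respondsAt_snoc_iff.1 h).resolve_right fun h => by omega
  · exact respondsAt_snoc_iff.2 (Or.inl h)

theorem Precedes.completeIn {k' : ℕ} (h : Precedes H k k') : CompleteIn H k := by
  obtain ⟨m, r, h, -⟩ := h
  exact ⟨m, r, h⟩

theorem Precedes.lt {k' : ℕ} (h : Precedes H k k') : k < k' := by
  obtain ⟨m, r, ⟨_, _, -, hkm, -⟩, hm⟩ := h
  exact hkm.trans hm

namespace Pending

theorem lt_length (h : Pending H p k o) : k < H.length :=
  (List.getElem?_eq_some_iff.1 h.invoked).1

theorem not_completeIn (h : Pending H p k o) : ¬ CompleteIn H k := by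
  rintro ⟨m, r, q, o', hk, hkm, hm, -⟩
  obtain ⟨rfl, -⟩ : p = q ∧ o = o' := by simpa using h.invoked.symm.trans hk
  exact h.not_resp m hkm r hm

theorem proc_eq (h : Pending H p k o) {q : Fin n} {o' : RegOp V} (h' : Pending H q k o') :
    p = q := by
  have hinv : p = q ∧ o = o' := by simpa using h.invoked.symm.trans h'.invoked
  exact hinv.1

theorem append (h : Pending H p k o) {L : History n V} (hL : ∀ r, Event.resp p r ∉ L) :
    Pending (H ++ L) p k o where
  invoked := (List.getElem?_append_left h.lt_length).trans h.invoked
  not_resp m hm r hr := by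
    rcases lt_or_ge m H.length with hmH | hmH
    · exact h.not_resp m hm r (by rwa [List.getElem?_append_left hmH] at hr)
    · exact hL r (List.mem_of_getElem? (by rwa [List.getElem?_append_right hmH] at hr))

theorem snoc (h : Pending H p k o) (he : ∀ r, e ≠ Event.resp p r) :
    Pending (H ++ [e]) p k o :=
  h.append fun r hr => he r (List.mem_singleton.1 hr).symm

theorem snoc_inv (H : History n V) (p : Fin n) (o : RegOp V) :
    Pending (H ++ [Event.inv p o]) p H.length o :=
  ⟨by simp, fun m hm r => by simp [hm]⟩

theorem completeIn_snoc_resp (h : Pending H p k o) (r : RegResp V) :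
    CompleteIn (H ++ [Event.resp p r]) k :=
  ⟨H.length, r, respondsAt_snoc_iff.2 (Or.inr ⟨rfl, p, o, rfl, h⟩)⟩

end Pending

/-- Every operation of process `p` in `H` is complete. -/
def Quiescent (H : History n V) (p : Fin n) : Prop :=
  ∀ k o, H[k]? = some (Event.inv p o) → CompleteIn H k

/-- The operation `o` that `p` invokes at position `k` is the only pending operation of `p`. -/
structure SolePending (H : History n V) (p : Fin n) (k : ℕ) (o : RegOp V) : Prop
    extends Pending H p k o where
  completeIn_of_ne : ∀ k' o', H[k']? = some (Event.inv p o') → k' ≠ k → CompleteIn H k'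

theorem SolePending.eq_of_pending (h : SolePending H p k o) {k' : ℕ} {o' : RegOp V}
    (h' : Pending H p k' o') : k' = k :=
  by_contra fun hne => h'.not_completeIn (h.completeIn_of_ne k' o' h'.invoked hne)

theorem SolePending.snoc (h : SolePending H p k o) (hi : ∀ o, e ≠ Event.inv p o)
    (hr : ∀ r, e ≠ Event.resp p r) : SolePending (H ++ [e]) p k o where
  toPending := h.toPending.snoc hr
  completeIn_of_ne k' o' hk' hne := by
    rcases getElem?_snoc_eq_some_iff.1 hk' with hk' | ⟨-, rfl⟩
    · exact (h.completeIn_of_ne k' o' hk' hne).snoc e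
    · exact absurd rfl (hi o')

theorem Quiescent.snoc (h : Quiescent H p) (hi : ∀ o, e ≠ Event.inv p o) :
    Quiescent (H ++ [e]) p := by
  intro k o hk
  rcases getElem?_snoc_eq_some_iff.1 hk with hk | ⟨-, rfl⟩
  · exact (h k o hk).snoc e
  · exact absurd rfl (hi o)

theorem Quiescent.snoc_inv (h : Quiescent H p) (o : RegOp V) :
    SolePending (H ++ [Event.inv p o]) p H.length o where
  toPending := Pending.snoc_inv H p o
  completeIn_of_ne k' o' hk' hne :=
    (h k' o' ((getElem?_snoc_eq_some_iff.1 hk').resolve_right fun h => hne h.1)).snoc _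

theorem SolePending.snoc_resp (h : SolePending H p k o) (r : RegResp V) :
    Quiescent (H ++ [Event.resp p r]) p := by
  intro k' o' hk'
  rcases getElem?_snoc_eq_some_iff.1 hk' with hk' | ⟨-, hk'⟩
  · rcases eq_or_ne k' k with rfl | hne
    · exact h.completeIn_snoc_resp r
    · exact (h.completeIn_of_ne k' o' hk' hne).snoc _
  · cases hk'

end Histories

section Arrangements

variable {n : ℕ} {V : Type*} {H : History n V} {S X T Y : SeqHistory n V}

/-- The part of `IsLinearization` that does not concern the values that reads return. -/
structure IsArrangement (H : History n V) (S : SeqHistory n V) : Prop where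
  nodup : (S.map SeqOp.ident).Nodup
  invoked : ∀ e ∈ S, H[e.ident]? = some (Event.inv e.proc e.op)
  response : ∀ e ∈ S, ∀ m r, RespondsAt H e.ident m r → e.resp = r
  complete : ∀ k, CompleteIn H k → ∃ e ∈ S, e.ident = k
  order : S.Pairwise fun x y => ¬ Precedes H y.ident x.ident

namespace IsArrangement

theorem nil : IsArrangement ([] : History n V) [] where
  nodup := List.nodup_nil
  invoked := by simp
  response := by simp
  complete := by
    rintro k ⟨m, r, h⟩
    exact absurd h.lt_length (Nat.not_lt_zero m)
  order := List.Pairwise.nil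

theorem ident_lt_length (h : IsArrangement H S) {x : SeqOp n V} (hx : x ∈ S) :
    x.ident < H.length :=
  (List.getElem?_eq_some_iff.1 (h.invoked x hx)).1

theorem eq_of_ident_eq (h : IsArrangement H S) {x y : SeqOp n V} (hx : x ∈ S) (hy : y ∈ S)
    (hxy : x.ident = y.ident) : x = y :=
  List.inj_on_of_nodup_map h.nodup hx hy hxy

theorem order_snoc (h : IsArrangement H S) (e : Event n V) :
    S.Pairwise fun x y => ¬ Precedes (H ++ [e]) y.ident x.ident :=
  h.order.imp_of_mem fun hx _ hxy => by rwa [precedes_snoc_iff (h.ident_lt_length hx).le]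

theorem snoc_of_forall_ne_resp (h : IsArrangement H S) {e : Event n V}
    (he : ∀ p r, e ≠ Event.resp p r) : IsArrangement (H ++ [e]) S where
  nodup := h.nodup
  invoked x hx := getElem?_snoc_eq_some_iff.2 (Or.inl (h.invoked x hx))
  response x hx m r hr := by
    rcases respondsAt_snoc_iff.1 hr with hr | ⟨-, p, o, hp, -⟩
    · exact h.response x hx m r hr
    · exact absurd hp (he p r)
  complete k hk := h.complete k ((completeIn_snoc_iff_of_forall_ne_resp he).1 hk)
  order := h.order_snoc e

theorem snoc_resp (h : IsArrangement H S) {x : SeqOp n V} (hx : x ∈ S) {p : Fin n} {o : RegOp V}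
    (hp : SolePending H p x.ident o) : IsArrangement (H ++ [Event.resp p x.resp]) S where
  nodup := h.nodup
  invoked y hy := getElem?_snoc_eq_some_iff.2 (Or.inl (h.invoked y hy))
  response y hy m r hr := by
    rcases respondsAt_snoc_iff.1 hr with hr | ⟨-, q, o', hq, hpend⟩
    · exact h.response y hy m r hr
    · obtain ⟨rfl, rfl⟩ : p = q ∧ x.resp = r := by simpa using hq
      rw [h.eq_of_ident_eq hy hx (hp.eq_of_pending hpend)]
  complete k := by
    rintro ⟨m, r, hr⟩
    rcases respondsAt_snoc_iff.1 hr with hr | ⟨-, q, o', hq, hpend⟩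
    · exact h.complete k ⟨m, r, hr⟩
    · obtain ⟨rfl, -⟩ : p = q ∧ x.resp = r := by simpa using hq
      exact ⟨x, hx, (hp.eq_of_pending hpend).symm⟩
  order := h.order_snoc _

theorem insert_pending (h : IsArrangement H (X ++ Y)) (hnodup : (T.map SeqOp.ident).Nodup)
    (hT : ∀ e ∈ T, Pending H e.proc e.ident e.op)
    (hnew : ∀ e ∈ T, ∀ x ∈ X ++ Y, x.ident ≠ e.ident)
    (hY : ∀ e ∈ T, ∀ y ∈ Y, ¬ Precedes H y.ident e.ident) : IsArrangement H (X ++ T ++ Y) := by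
  have hperm : (X ++ T ++ Y).Perm (X ++ Y ++ T) := by
    simpa only [List.append_assoc] using List.perm_append_comm.append_left X
  have hmem {x : SeqOp n V} : x ∈ X ++ T ++ Y → x ∈ X ++ Y ∨ x ∈ T := fun hx =>
    List.mem_append.1 (hperm.subset hx)
  have hpend {e : SeqOp n V} (he : e ∈ T) (k : ℕ) : ¬ Precedes H e.ident k := fun hek =>
    (hT e he).not_completeIn hek.completeIn
  obtain ⟨hX, hY', hXY⟩ := List.pairwise_append.1 h.order
  refine ⟨?_, fun x hx => ?_, fun x hx m r hr => ?_, fun k hk => ?_, ?_⟩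
  · rw [(hperm.map _).nodup_iff, List.map_append, List.nodup_append]
    refine ⟨h.nodup, hnodup, ?_⟩
    simp only [List.forall_mem_map]
    exact fun x hx e he => hnew e he x hx
  · exact (hmem hx).elim (h.invoked x) fun hx => (hT x hx).invoked
  · exact (hmem hx).elim (fun hx => h.response x hx m r hr)
      fun hx => absurd ⟨m, r, hr⟩ (hT x hx).not_completeIn
  · obtain ⟨x, hx, hxk⟩ := h.complete k hk
    exact ⟨x, hperm.symm.subset (List.mem_append_left T hx), hxk⟩
  · have hTT : T.Pairwise fun x y => ¬ Precedes H y.ident x.ident :=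
      List.pairwise_iff_forall_sublist.2 fun hxy => hpend (hxy.subset (by simp)) _
    refine List.pairwise_append.2 ⟨List.pairwise_append.2 ⟨hX, hTT, fun _ _ e he => hpend he _⟩,
      hY', fun x hx y hy => ?_⟩
    exact (List.mem_append.1 hx).elim (fun hx => hXY x hx y hy) fun hx => hY x hx y hy

end IsArrangement

/-- Every read in a sequential history returns the value of the last write before it, or `v` if
there is none. -/
def ReadsLast (v : V) : SeqHistory n V → Prop
  | [] => True
  | SeqOp.read _ _ w :: S => w = v ∧ ReadsLast v S
  | SeqOp.write _ _ w :: S => ReadsLast w S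

theorem ReadsLast.eq_lastValue {v w : V} (h : ReadsLast v S) {i k : ℕ} {p : Fin n}
    (hi : S[i]? = some (SeqOp.read p k w)) : w = lastValue v (S.take i) := by
  induction S generalizing v i with
  | nil => simp at hi
  | cons e S ih =>
    cases i with
    | zero =>
      obtain rfl : e = SeqOp.read p k w := by simpa using hi
      exact h.1
    | succ i =>
      cases e with
      | read q j x => simpa [lastValue] using ih h.2 (by simpa using hi)
      | write q j x => simpa [lastValue] using ih (v := x) h (by simpa using hi)

theorem readsLast_map_read_append_iff {v : V} {l : List (Fin n × ℕ)} :
    ReadsLast v ((l.map fun i => SeqOp.read i.1 i.2 v) ++ S) ↔ ReadsLast v S := by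
  induction l with
  | nil => rfl
  | cons _ _ ih => exact (and_iff_right rfl).trans ih

theorem IsArrangement.isLinearization {v₀ : V} (h : IsArrangement H S) (hr : ReadsLast v₀ S) :
    IsLinearization v₀ H S where
  nodup := h.nodup
  invoked := h.invoked
  response := h.response
  complete := h.complete
  order i j hi hj hij := by
    by_contra hlt
    rcases (not_lt.1 hlt).eq_or_lt with rfl | hji
    · exact hij.lt.false
    · exact List.pairwise_iff_getElem.1 h.order j i hj hi hji hij
  reads _ _ _ _ hi := hr.eq_lastValue hi

end Arrangements

section StrongLinearizability

variable {n : ℕ} {V : Type*} {v₀ : V} {H : History n V} {S X Y : SeqHistory n V}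
  {ℋ : Set (History n V)}

theorem StronglyLinearizable.writeStronglyLinearizable (h : StronglyLinearizable v₀ ℋ) :
    WriteStronglyLinearizable v₀ ℋ := by
  obtain ⟨f, hf, hprefix⟩ := h
  exact ⟨f, hf, fun G hG H hH hGH => (hprefix G hG H hH hGH).filter _⟩

theorem exists_forall_prefix_rel {α β : Type*} {P : List α → β → Prop} {r : β → β → Prop}
    [Std.Refl r] [IsTrans β r] {b₀ : β} (h₀ : P [] b₀)
    (hstep : ∀ H b, P H b → ∀ e, ∃ b', r b b' ∧ P (H ++ [e]) b') :
    ∃ f : List α → β, (∀ H, P H (f H)) ∧ ∀ G H, G <+: H → r (f G) (f H) := by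
  choose next hr hP using hstep
  let f : ∀ H, {b // P H b} := fun H =>
    List.reverseRecOn H ⟨b₀, h₀⟩ fun H e b => ⟨next H b b.2 e, hP H b b.2 e⟩
  refine ⟨fun H => f H, fun H => (f H).2, ?_⟩
  rintro G _ ⟨T, rfl⟩
  change r (f G).1 (f (G ++ T)).1
  induction T using List.reverseRecOn with
  | nil =>
    rw [List.append_nil]
    exact refl_of r _
  | append_singleton T e ih =>
    have hsnoc : (f (G ++ T ++ [e])).1 = next (G ++ T) (f (G ++ T)) (f (G ++ T)).2 e := by
      simp only [f, List.reverseRecOn_concat]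
    rw [← List.append_assoc, hsnoc]
    exact trans_of r ih (hr _ _ _ _)

theorem SeqOp.exists_eq_read {e : SeqOp n V} {v : V} (h : e.resp = RegResp.val v) :
    ∃ p, e = SeqOp.read p e.ident v := by
  cases e with
  | read p k w => exact ⟨p, by simpa [SeqOp.resp, SeqOp.ident] using h⟩
  | write p k w => cases h

theorem exists_write_lastValue_mem {e : SeqOp n V} (he : e ∈ S) (hw : e.isWrite) (v : V) :
    ∃ p k, SeqOp.write p k (lastValue v S) ∈ S := by
  induction S using List.reverseRecOn with
  | nil => cases he
  | append_singleton S e' ih =>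
    cases e' with
    | write p k w => exact ⟨p, k, by simp [lastValue]⟩
    | read p k w =>
      have heS : e ∈ S := (List.mem_append.1 he).resolve_right fun he => by
        rw [List.mem_singleton.1 he] at hw
        cases hw
      obtain ⟨q, j, hmem⟩ := ih heS
      exact ⟨q, j, by simpa [lastValue] using hmem⟩

namespace IsLinearization

theorem exists_mem_of_respondsAt (h : IsLinearization v₀ H S) {k m : ℕ} {r : RegResp V}
    (hr : RespondsAt H k m r) : ∃ e ∈ S, e.ident = k ∧ e.resp = r := by
  obtain ⟨e, he, rfl⟩ := h.complete k ⟨m, r, hr⟩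
  exact ⟨e, he, rfl, h.response e he m r hr⟩

theorem not_isWrite_of_mem_of_read_initial {p : Fin n} {k : ℕ}
    (h : IsLinearization v₀ H (X ++ SeqOp.read p k v₀ :: Y))
    (hv₀ : ∀ q, Event.inv q (RegOp.write v₀) ∉ H) {e : SeqOp n V} (he : e ∈ X) :
    ¬ e.isWrite := by
  intro hw
  have hlast : v₀ = lastValue v₀ X := by simpa using h.reads X.length p k v₀ (by simp)
  obtain ⟨q, j, hmem⟩ := exists_write_lastValue_mem he hw v₀
  rw [← hlast] at hmem
  exact hv₀ q (List.mem_of_getElem? (h.invoked _ (List.mem_append_left _ hmem)))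

end IsLinearization

theorem not_stronglyLinearizable_of_fork {G A B : History n V} (hG : G ∈ ℋ) (hA : A ∈ ℋ)
    (hB : B ∈ ℋ) (hGA : G <+: A) (hGB : G <+: B) {w k m m' : ℕ} {p : Fin n} {x : V}
    {r : RegResp V} (hwG : G[w]? = some (Event.inv p (RegOp.write x))) (hw : CompleteIn G w)
    (hAk : RespondsAt A k m (RegResp.val v₀)) (hv₀ : ∀ q, Event.inv q (RegOp.write v₀) ∉ A)
    (hBk : RespondsAt B k m' r) (hr : r ≠ RegResp.val v₀) : ¬ StronglyLinearizable v₀ ℋ := by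
  rintro ⟨f, hf, hprefix⟩
  obtain ⟨a, ha, rfl, har⟩ := (hf A hA).exists_mem_of_respondsAt hAk
  obtain ⟨q, hq⟩ := SeqOp.exists_eq_read har
  obtain ⟨X, Y, hXY⟩ := List.append_of_mem ha
  have hwrite : ∃ e ∈ f G, e.isWrite := by
    obtain ⟨e, he, rfl⟩ := (hf G hG).complete w hw
    have hop := ((hf G hG).invoked e he).symm.trans hwG
    cases e with
    | read _ _ _ => simp [SeqOp.op] at hop
    | write q j y => exact ⟨_, he, rfl⟩
  have haG : a ∈ f G := by
    have hfGA := hprefix G hG A hA hGA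
    have hXA : X ++ [a] <+: f A := ⟨Y, by simp [hXY]⟩
    rcases List.prefix_or_prefix_of_prefix hXA hfGA with hXG | hGX
    · exact hXG.subset (by simp)
    rcases List.prefix_concat_iff.1 hGX with hGX | hGX
    · simp [hGX]
    · obtain ⟨e, he, hew⟩ := hwrite
      have hlin : IsLinearization v₀ A (X ++ SeqOp.read q a.ident v₀ :: Y) :=
        hq ▸ hXY ▸ hf A hA
      exact absurd hew (hlin.not_isWrite_of_mem_of_read_initial hv₀ (hGX.subset he))
  have haB := (hf B hB).response a ((hprefix G hG B hB hGB).subset haG) _ _ hBk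
  exact hr (haB.symm.trans har)

end StrongLinearizability

/-- The process that performs an event. -/
def Event.proc {n : ℕ} {V : Type*} : Event n V → Fin n
  | Event.inv p _ => p
  | Event.baseRead p _ _ => p
  | Event.baseWrite p _ => p
  | Event.resp p _ => p

theorem toLex_lt_toLex_update {ι α : Type*} [LinearOrder ι] [WellFoundedLT ι] [PartialOrder α]
    [OrderTop α] {x y : ι → α} {i : ι} {a : α} (h : toLex x < toLex y)
    (hy : ∀ j, i ≤ j → y j = ⊤) (hx : x i ≠ ⊤) (ha : x i ≤ a) (hne : x ≠ Function.update y i a) :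
    toLex x < toLex (Function.update y i a) := by
  obtain ⟨d, hd, hlt⟩ := h
  simp only [Pi.toLex_apply] at hd hlt
  rcases lt_trichotomy d i with hdi | rfl | hdi
  · refine ⟨d, fun j hj => ?_, ?_⟩
    · simp [(hj.trans hdi).ne, hd j hj]
    · simpa [hdi.ne] using hlt
  · refine Pi.toLex_strictMono (lt_of_le_of_ne (fun j => ?_) hne)
    rcases lt_trichotomy j d with hj | rfl | hj
    · simp [hj.ne, hd j hj]
    · simpa using ha
    · simp [hj.ne', hy j hj.le]
  · exact absurd ((hd i hdi).trans (hy i le_rfl)) hx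

namespace VectorClock

variable {n : ℕ} {V : Type*} {v₀ : V}

theorem Step.unique {s s₁ s₂ : Config n V} {e : Event n V} (h₁ : Step s e s₁)
    (h₂ : Step s e s₂) : s₁ = s₂ := by
  generalize he : e = e' at h₂
  cases h₁ <;> cases h₂ <;> simp_all

theorem Run.exists_of_snoc {H : History n V} {e : Event n V} {s' : Config n V}
    (h : Run v₀ (H ++ [e]) s') : ∃ s, Run v₀ H s ∧ Step s e s' := by
  generalize hH : H ++ [e] = H' at h
  cases h with
  | nil => simp at hH
  | snoc hr hs =>
    obtain ⟨rfl, h⟩ := List.append_inj' hH rfl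
    obtain rfl : e = _ := by simpa using h
    exact ⟨_, hr, hs⟩

theorem Run.unique {H : History n V} {s₁ s₂ : Config n V} (h₁ : Run v₀ H s₁)
    (h₂ : Run v₀ H s₂) : s₁ = s₂ := by
  induction h₁ generalizing s₂ with
  | nil =>
    generalize hH : ([] : History n V) = H' at h₂
    cases h₂ with
    | nil => rfl
    | snoc => simp at hH
  | snoc _ hs ih =>
    obtain ⟨s, hr, hs'⟩ := h₂.exists_of_snoc
    obtain rfl := ih hr
    exact hs.unique hs'

section StampBounds

variable {s : Config n V} {val : Fin n → Cell n V} {p : Fin n} {v : V} {ts : Stamp n}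

/-- The array `new_ts` of process `p` after the first `i` iterations of the loop of a write, when
the contents of the shared registers are `val`. -/
structure WritingBounds (val : Fin n → Cell n V) (p : Fin n) (i : ℕ) (ts : Stamp n) : Prop where
  top_of_le : ∀ j : Fin n, i ≤ j → ts j = ⊤
  mem_Icc : ∀ j : Fin n, j < i → j ≠ p → ts j ∈ Set.Icc ((val p).2 j) ((val j).2 j)
  own : p < i → ts p = (val p).2 p + 1

/-- The bounds on the timestamps in the control state of process `p`, when the contents of the
shared registers are `val`. -/
def LocalBounds (val : Fin n → Cell n V) (p : Fin n) : Local n V → Prop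
  | Local.writing _ i ts => WritingBounds val p i ts
  | Local.reading cs => ∀ c ∈ cs, ∀ i, c.2 i ≤ (val i).2 i
  | _ => True

/-- The bounds on the timestamps in a reachable configuration: the greatest `i`-th component that
is visible is the one in `Val[i]`. -/
structure StampBounds (s : Config n V) : Prop where
  le_diag : ∀ j i, (s.val j).2 i ≤ (s.val i).2 i
  diag_ne_top : ∀ i, (s.val i).2 i ≠ ⊤
  loc : ∀ p, LocalBounds s.val p (s.loc p)

/-- The array `new_ts` of process `p` after the iteration `i` of the loop of a write. -/
def scanStamp (s : Config n V) (p i : Fin n) (ts : Stamp n) : Stamp n :=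
  Function.update ts i (if i = p then (s.val i).2 i + 1 else (s.val i).2 i)

theorem LocalBounds.mono {val' : Fin n → Cell n V} {l : Local n V} (h : LocalBounds val p l)
    (hp : val' p = val p) (hle : ∀ i, (val i).2 i ≤ (val' i).2 i) : LocalBounds val' p l := by
  cases l with
  | idle => trivial
  | written => trivial
  | reading cs => exact fun c hc i => (h c hc i).trans (hle i)
  | writing v i ts =>
    refine ⟨h.top_of_le, fun j hj hjp => ?_, ?_⟩
    · rw [hp]
      exact ⟨(h.mem_Icc j hj hjp).1, (h.mem_Icc j hj hjp).2.trans (hle j)⟩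
    · rw [hp]
      exact h.own

namespace StampBounds

theorem init (v₀ : V) : StampBounds (Config.init n v₀) := by
  constructor <;> simp [Config.init, LocalBounds]

theorem ne_top (h : StampBounds s) (j i : Fin n) : (s.val j).2 i ≠ ⊤ :=
  ne_top_of_le_ne_top (h.diag_ne_top i) (h.le_diag j i)

theorem writing (h : StampBounds s) {i : ℕ} (hp : s.loc p = Local.writing v i ts) :
    WritingBounds s.val p i ts := by
  simpa only [hp, LocalBounds] using h.loc p

theorem reading (h : StampBounds s) {cs : List (Cell n V)} (hp : s.loc p = Local.reading cs)
    {c : Cell n V} (hc : c ∈ cs) (i : Fin n) : c.2 i ≤ (s.val i).2 i := by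
  have hb := h.loc p
  rw [hp] at hb
  exact hb c hc i

theorem setLoc (h : StampBounds s) {l : Local n V} (hl : LocalBounds s.val p l) :
    StampBounds (s.setLoc p l) where
  le_diag := h.le_diag
  diag_ne_top := h.diag_ne_top
  loc := (Function.forall_update_iff s.loc fun q l => LocalBounds s.val q l).2
    ⟨hl, fun q _ => h.loc q⟩

theorem own_lt (h : StampBounds s) {i : ℕ} (hp : s.loc p = Local.writing v i ts) :
    (s.val p).2 p < ts p := by
  rcases lt_or_ge (p : ℕ) i with hpi | hip
  · rw [(h.writing hp).own hpi]
    exact ENat.lt_add_one_iff (h.diag_ne_top p) |>.2 le_rfl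
  · rw [(h.writing hp).top_of_le p hip]
    exact (h.diag_ne_top p).lt_top

theorem val_le (h : StampBounds s) {i : ℕ} (hp : s.loc p = Local.writing v i ts) :
    (s.val p).2 ≤ ts := by
  intro j
  rcases lt_or_ge (j : ℕ) i with hji | hij
  · rcases eq_or_ne j p with rfl | hjp
    · exact (h.own_lt hp).le
    · exact ((h.writing hp).mem_Icc j hji hjp).1
  · rw [(h.writing hp).top_of_le j hij]
    exact le_top

theorem ne_stamp (h : StampBounds s) {i : ℕ} (hp : s.loc p = Local.writing v i ts) {m : Stamp n}
    (hm : m p ≤ (s.val p).2 p) : m ≠ ts := by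
  rintro rfl
  exact hm.not_gt (h.own_lt hp)

theorem writingBounds_scanStamp (h : StampBounds s) {i : Fin n}
    (hp : s.loc p = Local.writing v i ts) :
    WritingBounds s.val p (i + 1) (scanStamp s p i ts) := by
  have hb := h.writing hp
  refine ⟨fun j hj => ?_, fun j hj hjp => ?_, fun hpi => ?_⟩
  · have hji : j ≠ i := by rintro rfl; omega
    simpa [scanStamp, hji] using hb.top_of_le j (by omega)
  · rcases eq_or_ne j i with rfl | hji
    · simpa [scanStamp, hjp] using h.le_diag p j
    · simpa [scanStamp, hji] using hb.mem_Icc j (by have := Fin.val_ne_of_ne hji; omega) hjp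
  · rcases eq_or_ne p i with rfl | hne
    · simp [scanStamp]
    · simpa [scanStamp, hne] using hb.own (by have := Fin.val_ne_of_ne hne; omega)

theorem scan (h : StampBounds s) {i : Fin n} (hp : s.loc p = Local.writing v i ts) :
    StampBounds (s.setLoc p (Local.writing v (i + 1) (scanStamp s p i ts))) :=
  h.setLoc (h.writingBounds_scanStamp hp)

theorem scanStamp_le (h : StampBounds s) {i : Fin n} (hp : s.loc p = Local.writing v i ts) :
    toLex (scanStamp s p i ts) ≤ toLex ts :=
  Pi.toLex_update_le_self_iff.2 (((h.writing hp).top_of_le i le_rfl).symm ▸ le_top)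

theorem lt_scanStamp (h : StampBounds s) {i : Fin n} (hp : s.loc p = Local.writing v i ts)
    {j : Fin n} (hlt : toLex (s.val j).2 < toLex ts) :
    toLex (s.val j).2 < toLex (scanStamp s p i ts) := by
  have hne : (s.val j).2 ≠ scanStamp s p i ts :=
    (h.scan hp).ne_stamp (p := p) (v := v) (i := i + 1) (by simp [Config.setLoc]) (h.le_diag j p)
  refine toLex_lt_toLex_update hlt (h.writing hp).top_of_le (h.ne_top j i) ?_ hne
  split_ifs
  · exact (h.le_diag j i).trans le_self_add
  · exact h.le_diag j i

theorem diag_le_store (h : StampBounds s) {k : ℕ} (hp : s.loc p = Local.writing v k ts)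
    (i : Fin n) : (s.val i).2 i ≤ (Function.update s.val p (v, ts) i).2 i := by
  rcases eq_or_ne i p with rfl | hi
  · simpa using (h.own_lt hp).le
  · simp [hi]

theorem store (h : StampBounds s) (hp : s.loc p = Local.writing v n ts) :
    StampBounds ((s.setVal p (v, ts)).setLoc p Local.written) where
  le_diag j i := by
    rcases eq_or_ne j p with rfl | hj
    · rcases eq_or_ne i j with rfl | hi
      · exact le_rfl
      · simpa [Config.setLoc, Config.setVal, hi] using ((h.writing hp).mem_Icc i i.2 hi).2
    · refine le_trans ?_ (h.diag_le_store hp i)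
      simpa [Config.setLoc, Config.setVal, hj] using h.le_diag j i
  diag_ne_top i := by
    rcases eq_or_ne i p with rfl | hi
    · simp [Config.setLoc, Config.setVal, (h.writing hp).own i.2, h.diag_ne_top]
    · simpa [Config.setLoc, Config.setVal, hi] using h.diag_ne_top i
  loc := (Function.forall_update_iff s.loc fun q l => LocalBounds _ q l).2
    ⟨trivial, fun q hq => (h.loc q).mono (Function.update_of_ne hq _ _) (h.diag_le_store hp)⟩

theorem step (h : StampBounds s) {s' : Config n V} {e : Event n V} (hs : Step s e s') :
    StampBounds s' := by
  cases hs with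
  | invWrite p v hp => exact h.setLoc ⟨fun _ _ => rfl, by simp, by simp⟩
  | writeScan p v i ts hp => exact h.scan hp
  | writeStore p v ts hp => exact h.store hp
  | writeReturn p hp => exact h.setLoc trivial
  | invRead p hp => exact h.setLoc (by simp [LocalBounds])
  | readScan p i cs hp hi =>
    refine h.setLoc fun c hc j => ?_
    rcases List.mem_append.1 hc with hc | hc
    · exact h.reading hp hc j
    · rw [List.mem_singleton.1 hc]
      exact h.le_diag i j
  | readReturn p cs c hp hlen hc hmax => exact h.setLoc trivial

end StampBounds

end StampBounds

section Tracks

variable {H : History n V} {p : Fin n} {k : ℕ} {loc : Fin n → Local n V} {id : Fin n → ℕ}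

/-- The control state of process `p` is the one of the execution of the operation that `p` invokes
at position `k` of `H`, or `p` is idle and has no pending operation in `H`. -/
def TracksAt (H : History n V) (p : Fin n) (k : ℕ) : Local n V → Prop
  | Local.idle => Quiescent H p
  | Local.writing v _ _ => SolePending H p k (RegOp.write v)
  | Local.written => ∃ v, SolePending H p k (RegOp.write v)
  | Local.reading _ => SolePending H p k RegOp.read

/-- For every process, `TracksAt` holds with `id p` as the position of the last invocation. -/
def Tracks (H : History n V) (loc : Fin n → Local n V) (id : Fin n → ℕ) : Prop :=
  ∀ p, TracksAt H p (id p) (loc p)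

theorem TracksAt.snoc {l : Local n V} (h : TracksAt H p k l) {e : Event n V}
    (hi : ∀ o, e ≠ Event.inv p o) (hr : ∀ r, e ≠ Event.resp p r) : TracksAt (H ++ [e]) p k l := by
  cases l with
  | idle => exact Quiescent.snoc h hi
  | writing v i ts => exact SolePending.snoc h hi hr
  | written => exact h.imp fun _ h => h.snoc hi hr
  | reading cs => exact SolePending.snoc h hi hr

namespace Tracks

theorem nil : Tracks ([] : History n V) (fun _ => Local.idle) id :=
  fun p k o hk => by simp at hk

theorem quiescent (h : Tracks H loc id) (hp : loc p = Local.idle) : Quiescent H p := by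
  simpa only [hp, TracksAt] using h p

theorem of_writing (h : Tracks H loc id) {v : V} {i : ℕ} {ts : Stamp n}
    (hp : loc p = Local.writing v i ts) : SolePending H p (id p) (RegOp.write v) := by
  simpa only [hp, TracksAt] using h p

theorem of_written (h : Tracks H loc id) (hp : loc p = Local.written) :
    ∃ v, SolePending H p (id p) (RegOp.write v) := by
  simpa only [hp, TracksAt] using h p

theorem of_reading (h : Tracks H loc id) {cs : List (Cell n V)}
    (hp : loc p = Local.reading cs) : SolePending H p (id p) RegOp.read := by
  simpa only [hp, TracksAt] using h p

theorem snoc_update (h : Tracks H loc id) {e : Event n V} {l : Local n V}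
    (hl : TracksAt (H ++ [e]) e.proc k l) :
    Tracks (H ++ [e]) (Function.update loc e.proc l) (Function.update id e.proc k) := by
  intro q
  rcases eq_or_ne q e.proc with rfl | hq
  · simpa using hl
  · simp only [Function.update_of_ne hq]
    refine (h q).snoc ?_ ?_ <;> rintro x rfl <;> exact hq rfl

theorem snoc_update_loc (h : Tracks H loc id) {e : Event n V} {l : Local n V}
    (hl : TracksAt (H ++ [e]) e.proc (id e.proc) l) :
    Tracks (H ++ [e]) (Function.update loc e.proc l) id := by
  simpa using h.snoc_update hl

end Tracks

end Tracks

/-- A committed write with the current value of its timestamp. The write is given by its process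
and its identity; `none` stands for the initial value. -/
structure LogEntry (n : ℕ) (V : Type*) where
  write : Option (Fin n × ℕ)
  val : V
  stamp : Stamp n

section Log

variable {s : Config n V} {id : Fin n → ℕ} {E E' : List (LogEntry n V)} {p q : Fin n}
  {k : ℕ} {v : V} {ts : Stamp n}

/-- The tuple `c` is the one that some committed write stores. -/
def Recorded (E : List (LogEntry n V)) (c : Cell n V) : Prop :=
  ∃ b ∈ E, b.val = c.1 ∧ b.stamp = c.2

/-- The log `E` agrees with the control state of process `q` during the operation with identity
`k`. The stamp of an active write may decrease as long as the write is not committed, but it stays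
above the stamps of the committed writes. -/
def LocAgrees (E : List (LogEntry n V)) (q : Fin n) (k : ℕ) : Local n V → Prop
  | Local.idle => True
  | Local.writing v _ ts =>
    (∀ b ∈ E, b.write = some (q, k) → b.val = v ∧ b.stamp = ts) ∧
      ((∀ b ∈ E, b.write ≠ some (q, k)) → ∀ b ∈ E, toLex b.stamp < toLex ts)
  | Local.written => ∃ b ∈ E, b.write = some (q, k)
  | Local.reading cs => ∀ c ∈ cs, Recorded E c

/-- The log `E` of committed writes agrees with the configuration `s`. The last entry is the only
one with the greatest stamp, and its write has stored its tuple. -/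
structure LogAgrees (s : Config n V) (id : Fin n → ℕ) (E : List (LogEntry n V)) : Prop where
  top : ∃ j, (∀ b ∈ E, toLex b.stamp ≤ toLex (s.val j).2) ∧
    E.Pairwise fun b _ => toLex b.stamp < toLex (s.val j).2
  recorded : ∀ j, Recorded E (s.val j)
  loc : ∀ q, LocAgrees E q (id q) (s.loc q)

theorem Recorded.mono {c : Cell n V} (h : Recorded E c) (hE : E ⊆ E') : Recorded E' c := by
  obtain ⟨b, hb, hbc⟩ := h
  exact ⟨b, hE hb, hbc⟩

/-- The entry `b` with the stamp `ts` if it is the entry of the write `w`. -/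
def LogEntry.restamp (w : Fin n × ℕ) (ts : Stamp n) (b : LogEntry n V) : LogEntry n V :=
  if b.write = some w then { b with stamp := ts } else b

theorem LogEntry.restamp_write (w : Fin n × ℕ) (ts : Stamp n) (b : LogEntry n V) :
    (b.restamp w ts).write = b.write := by
  unfold LogEntry.restamp
  split_ifs <;> rfl

theorem LogEntry.restamp_val (w : Fin n × ℕ) (ts : Stamp n) (b : LogEntry n V) :
    (b.restamp w ts).val = b.val := by
  unfold LogEntry.restamp
  split_ifs <;> rfl

theorem LogEntry.restamp_of_eq {w : Fin n × ℕ} {b : LogEntry n V} (h : b.write = some w)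
    (ts : Stamp n) : b.restamp w ts = { b with stamp := ts } :=
  if_pos h

theorem LogEntry.restamp_of_ne {w : Fin n × ℕ} {b : LogEntry n V} (h : b.write ≠ some w)
    (ts : Stamp n) : b.restamp w ts = b :=
  if_neg h

namespace LogAgrees

theorem init (v₀ : V) (hn : 0 < n) (id : Fin n → ℕ) :
    LogAgrees (Config.init n v₀) id [⟨none, v₀, fun _ => 0⟩] where
  top := ⟨⟨0, hn⟩, by simp [Config.init]⟩
  recorded _ := ⟨_, List.mem_singleton_self _, rfl, rfl⟩
  loc _ := trivial

theorem writing (h : LogAgrees s id E) {i : ℕ} (hp : s.loc p = Local.writing v i ts) :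
    LocAgrees E p (id p) (Local.writing v i ts) :=
  hp ▸ h.loc p

theorem reading (h : LogAgrees s id E) {cs : List (Cell n V)} (hp : s.loc p = Local.reading cs) :
    LocAgrees E p (id p) (Local.reading cs) :=
  hp ▸ h.loc p

theorem setLoc_update (h : LogAgrees s id E) {l : Local n V} (hl : LocAgrees E p k l) :
    LogAgrees (s.setLoc p l) (Function.update id p k) E where
  top := h.top
  recorded := h.recorded
  loc q := by
    rcases eq_or_ne q p with rfl | hq
    · simpa [Config.setLoc] using hl
    · simpa [Config.setLoc, hq] using h.loc q

theorem setLoc (h : LogAgrees s id E) {l : Local n V} (hl : LocAgrees E p (id p) l) :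
    LogAgrees (s.setLoc p l) id E := by
  simpa using h.setLoc_update hl

theorem invWrite (h : LogAgrees s id E) (hs : StampBounds s) (hk : ∀ b ∈ E, b.write ≠ some (p, k))
    (v : V) : LogAgrees (s.setLoc p (Local.writing v 0 fun _ => ⊤)) (Function.update id p k) E := by
  refine h.setLoc_update ⟨fun b hb hw => absurd hw (hk b hb), fun _ b hb => ?_⟩
  obtain ⟨j, hj, -⟩ := h.top
  have hlt : (s.val j).2 < fun _ => ⊤ :=
    lt_of_le_of_ne (fun _ => le_top) fun heq => hs.ne_top j p (congrFun heq p)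
  exact (hj b hb).trans_lt (Pi.toLex_strictMono hlt)

section Scan

variable {i : Fin n}

theorem restamp_le (h : LogAgrees s id E) (hs : StampBounds s)
    (hp : s.loc p = Local.writing v i ts) {b : LogEntry n V} (hb : b ∈ E) :
    toLex (b.restamp (p, id p) (scanStamp s p i ts)).stamp ≤ toLex b.stamp := by
  by_cases hw : b.write = some (p, id p)
  · rw [LogEntry.restamp_of_eq hw, ((h.writing hp).1 b hb hw).2]
    exact hs.scanStamp_le hp
  · rw [LogEntry.restamp_of_ne hw]

theorem recorded_restamp (h : LogAgrees s id E) (hs : StampBounds s)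
    (hp : s.loc p = Local.writing v i ts) (ts' : Stamp n) {c : Cell n V} (hc : Recorded E c)
    (hcp : c.2 p ≤ (s.val p).2 p) : Recorded (E.map (LogEntry.restamp (p, id p) ts')) c := by
  obtain ⟨b, hb, hval, hstamp⟩ := hc
  have hw : b.write ≠ some (p, id p) := fun hw =>
    hs.ne_stamp hp hcp (hstamp.symm.trans ((h.writing hp).1 b hb hw).2)
  exact ⟨b, List.mem_map.2 ⟨b, hb, LogEntry.restamp_of_ne hw ts'⟩, hval, hstamp⟩

theorem lt_scanStamp (h : LogAgrees s id E) (hs : StampBounds s)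
    (hp : s.loc p = Local.writing v i ts) (hE : ∀ b ∈ E, toLex b.stamp < toLex ts)
    {b : LogEntry n V} (hb : b ∈ E) : toLex b.stamp < toLex (scanStamp s p i ts) := by
  obtain ⟨j, hj, -⟩ := h.top
  obtain ⟨b', hb', -, hstamp⟩ := h.recorded j
  exact (hj b hb).trans_lt (hs.lt_scanStamp hp (hstamp ▸ hE b' hb'))

theorem locAgrees_restamp_of_ne (h : LogAgrees s id E) (hs : StampBounds s)
    (hp : s.loc p = Local.writing v i ts) (hq : q ≠ p) :
    LocAgrees (E.map (LogEntry.restamp (p, id p) (scanStamp s p i ts))) q (id q) (s.loc q) := by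
  have hql := h.loc q
  cases hl : s.loc q with
  | idle => trivial
  | writing v' i' ts' =>
    rw [hl] at hql
    simp only [LocAgrees, List.forall_mem_map, LogEntry.restamp_write, LogEntry.restamp_val]
    refine ⟨fun b hb hw => ?_, fun hnew b hb => (h.restamp_le hs hp hb).trans_lt (hql.2 hnew b hb)⟩
    rw [LogEntry.restamp_of_ne (by simp [hw, hq])]
    exact hql.1 b hb hw
  | written =>
    rw [hl] at hql
    obtain ⟨b, hb, hw⟩ := hql
    exact ⟨_, List.mem_map_of_mem hb, (LogEntry.restamp_write _ _ b).trans hw⟩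
  | reading cs =>
    rw [hl] at hql
    exact fun c hc => h.recorded_restamp hs hp _ (hql c hc) (hs.reading hl hc p)

theorem scan (h : LogAgrees s id E) (hs : StampBounds s) (hp : s.loc p = Local.writing v i ts) :
    LogAgrees (s.setLoc p (Local.writing v (i + 1) (scanStamp s p i ts))) id
      (E.map (LogEntry.restamp (p, id p) (scanStamp s p i ts))) where
  top := by
    obtain ⟨j, hj, hpair⟩ := h.top
    refine ⟨j, List.forall_mem_map.2 fun b hb => (h.restamp_le hs hp hb).trans (hj b hb), ?_⟩
    exact List.pairwise_map.2
      (hpair.imp_of_mem fun hb _ hlt => (h.restamp_le hs hp hb).trans_lt hlt)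
  recorded j := h.recorded_restamp hs hp _ (h.recorded j) (hs.le_diag j p)
  loc := by
    refine (Function.forall_update_iff s.loc fun q l => LocAgrees _ q (id q) l).2
      ⟨⟨?_, ?_⟩, fun q hq => h.locAgrees_restamp_of_ne hs hp hq⟩
    · simp only [List.forall_mem_map, LogEntry.restamp_write, LogEntry.restamp_val]
      intro b hb hw
      exact ⟨((h.writing hp).1 b hb hw).1, by rw [LogEntry.restamp_of_eq hw]⟩
    · simp only [List.forall_mem_map, LogEntry.restamp_write]
      intro hnew b hb
      rw [LogEntry.restamp_of_ne (hnew b hb)]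
      exact h.lt_scanStamp hs hp ((h.writing hp).2 hnew) hb

end Scan

theorem store_committed (h : LogAgrees s id E) (hs : StampBounds s)
    (hp : s.loc p = Local.writing v n ts) {b : LogEntry n V} (hb : b ∈ E)
    (hw : b.write = some (p, id p)) :
    LogAgrees ((s.setVal p (v, ts)).setLoc p Local.written) id E where
  top := by
    have hstamp : b.stamp = ts := ((h.writing hp).1 b hb hw).2
    obtain ⟨j, hj, hpair⟩ := h.top
    have hjp : j ≠ p := by
      rintro rfl
      have hlt : (s.val j).2 < ts :=
        lt_of_le_of_ne (hs.val_le hp) (hs.ne_stamp hp le_rfl)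
      exact (hj b hb).not_gt (hstamp ▸ Pi.toLex_strictMono hlt)
    exact ⟨j, by simpa [Config.setLoc, Config.setVal, hjp] using And.intro hj hpair⟩
  recorded := (Function.forall_update_iff s.val fun _ c => Recorded E c).2
    ⟨⟨b, hb, (h.writing hp).1 b hb hw⟩, fun j _ => h.recorded j⟩
  loc := (Function.forall_update_iff s.loc fun q l => LocAgrees E q (id q) l).2
    ⟨⟨b, hb, hw⟩, fun q _ => h.loc q⟩

end LogAgrees

section Batch

/-- The log entry of the write that a process `q` is executing and has not stored yet. -/
def activeEntry (k : ℕ) (q : Fin n) : Local n V → Option (LogEntry n V)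
  | Local.writing v _ ts => some ⟨some (q, k), v, ts⟩
  | _ => none

theorem activeEntry_eq_some_iff {l : Local n V} {b : LogEntry n V} :
    activeEntry k q l = some b ↔ ∃ v i ts, l = Local.writing v i ts ∧ b = ⟨some (q, k), v, ts⟩ := by
  cases l <;> simp [activeEntry, eq_comm]

open Classical in
/-- The entries of the uncommitted active writes whose stamps are smaller than `ts`. Their order
does not matter. -/
noncomputable def overtaken (s : Config n V) (id : Fin n → ℕ) (E : List (LogEntry n V))
    (ts : Stamp n) : List (LogEntry n V) :=
  (List.finRange n).filterMap fun q => (activeEntry (id q) q (s.loc q)).filter fun b =>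
    toLex b.stamp < toLex ts ∧ ∀ b' ∈ E, b'.write ≠ b.write

/-- The entries that are committed when process `p` stores the tuple `(v, ts)` of a write that is
not committed yet. -/
noncomputable def batch (s : Config n V) (id : Fin n → ℕ) (E : List (LogEntry n V)) (p : Fin n)
    (v : V) (ts : Stamp n) : List (LogEntry n V) :=
  overtaken s id E ts ++ [⟨some (p, id p), v, ts⟩]

theorem mem_overtaken_iff {b : LogEntry n V} : b ∈ overtaken s id E ts ↔
    ∃ q v i ts', s.loc q = Local.writing v i ts' ∧ b = ⟨some (q, id q), v, ts'⟩ ∧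
      toLex ts' < toLex ts ∧ ∀ b' ∈ E, b'.write ≠ some (q, id q) := by
  simp only [overtaken, List.mem_filterMap, List.mem_finRange, true_and, Option.filter_eq_some_iff,
    activeEntry_eq_some_iff, decide_eq_true_eq]
  constructor
  · rintro ⟨q, ⟨v, i, ts', hq, rfl⟩, hlt, hnew⟩
    exact ⟨q, v, i, ts', hq, rfl, hlt, hnew⟩
  · rintro ⟨q, v, i, ts', hq, rfl, hlt, hnew⟩
    exact ⟨q, ⟨v, i, ts', hq, rfl⟩, hlt, hnew⟩

theorem nodup_overtaken_map_write : ((overtaken s id E ts).map LogEntry.write).Nodup := by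
  refine List.pairwise_map.2 (List.pairwise_filterMap.2 ((List.nodup_finRange n).imp ?_))
  intro q q' hqq' b hb b' hb'
  obtain ⟨v, i, ts, -, rfl⟩ := activeEntry_eq_some_iff.1 (Option.filter_eq_some_iff.1 hb).1
  obtain ⟨v', i', ts', -, rfl⟩ := activeEntry_eq_some_iff.1 (Option.filter_eq_some_iff.1 hb').1
  simp [hqq']

theorem exists_of_mem_batch {b : LogEntry n V} (hp : s.loc p = Local.writing v n ts)
    (hnew : ∀ b' ∈ E, b'.write ≠ some (p, id p)) (hb : b ∈ batch s id E p v ts) :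
    ∃ q v i ts', s.loc q = Local.writing v i ts' ∧ b = ⟨some (q, id q), v, ts'⟩ ∧
      ∀ b' ∈ E, b'.write ≠ some (q, id q) := by
  rcases List.mem_append.1 hb with hb | hb
  · obtain ⟨q, v', i, ts', hq, hbq, -, hnew'⟩ := mem_overtaken_iff.1 hb
    exact ⟨q, v', i, ts', hq, hbq, hnew'⟩
  · exact ⟨p, v, n, ts, hp, List.mem_singleton.1 hb, hnew⟩

theorem nodup_batch_map_write (hp : s.loc p = Local.writing v n ts) :
    ((batch s id E p v ts).map LogEntry.write).Nodup := by
  simp only [batch, List.map_append, List.map_cons, List.map_nil]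
  refine nodup_overtaken_map_write.append (List.nodup_singleton _) ?_
  simp only [List.disjoint_singleton, List.mem_map, not_exists, not_and]
  rintro b hb hbw
  obtain ⟨q, v', i, ts', hq, rfl, hlt, -⟩ := mem_overtaken_iff.1 hb
  obtain ⟨rfl, -⟩ : q = p ∧ id q = id p := by simpa using hbw
  obtain ⟨-, -, rfl⟩ : v' = v ∧ i = n ∧ ts' = ts := by simpa using hq.symm.trans hp
  exact hlt.false

namespace LogAgrees

theorem lt_of_mem_append_overtaken (h : LogAgrees s id E) (hp : s.loc p = Local.writing v n ts)
    (hnew : ∀ b ∈ E, b.write ≠ some (p, id p)) :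
    ∀ b ∈ E ++ overtaken s id E ts, toLex b.stamp < toLex ts := by
  intro b hb
  rcases List.mem_append.1 hb with hb | hb
  · exact (h.writing hp).2 hnew b hb
  · obtain ⟨_, _, _, _, -, rfl, hlt, -⟩ := mem_overtaken_iff.1 hb
    exact hlt

theorem le_of_mem_append_batch (h : LogAgrees s id E) (hp : s.loc p = Local.writing v n ts)
    (hnew : ∀ b ∈ E, b.write ≠ some (p, id p)) :
    ∀ b ∈ E ++ batch s id E p v ts, toLex b.stamp ≤ toLex ts := by
  intro b hb
  rw [batch, ← List.append_assoc] at hb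
  rcases List.mem_append.1 hb with hb | hb
  · exact (h.lt_of_mem_append_overtaken hp hnew b hb).le
  · rw [List.mem_singleton.1 hb]

theorem locAgrees_append_batch_of_ne (h : LogAgrees s id E) (hs : StampBounds s)
    (hp : s.loc p = Local.writing v n ts) (hnew : ∀ b ∈ E, b.write ≠ some (p, id p))
    (hq : q ≠ p) : LocAgrees (E ++ batch s id E p v ts) q (id q) (s.loc q) := by
  have hsub : E ⊆ E ++ batch s id E p v ts := List.subset_append_left _ _
  have hql := h.loc q
  cases hl : s.loc q with
  | idle => trivial
  | writing v' i' ts' =>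
    rw [hl] at hql
    refine ⟨fun b hb hw => ?_, fun hnew' b hb => ?_⟩
    · rcases List.mem_append.1 hb with hb | hb
      · exact hql.1 b hb hw
      · obtain ⟨q', v'', i, ts'', hq', rfl, -⟩ := exists_of_mem_batch hp hnew hb
        obtain ⟨rfl, -⟩ : q' = q ∧ id q' = id q := by simpa using hw
        obtain ⟨rfl, -, rfl⟩ : v' = v'' ∧ i' = i ∧ ts' = ts'' := by simpa using hl.symm.trans hq'
        exact ⟨rfl, rfl⟩
    · have hge : ¬ toLex ts' < toLex ts := fun hlt =>
        hnew' _ (List.mem_append_right E (List.mem_append_left _ (mem_overtaken_iff.2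
          ⟨q, v', i', ts', hl, rfl, hlt, fun b' hb' => hnew' b' (hsub hb')⟩))) rfl
      have hne : ts ≠ ts' := (hs.store hp).ne_stamp (p := q) (v := v') (i := i')
        (by simpa [Config.setLoc, Config.setVal, hq] using hl)
        (by simpa [Config.setLoc, Config.setVal] using (hs.store hp).le_diag p q)
      exact (h.le_of_mem_append_batch hp hnew b hb).trans_lt
        (lt_of_le_of_ne (not_lt.1 hge) (toLex.injective.ne hne))
  | written =>
    rw [hl] at hql
    obtain ⟨b, hb, hw⟩ := hql
    exact ⟨b, hsub hb, hw⟩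
  | reading cs =>
    rw [hl] at hql
    exact fun c hc => (hql c hc).mono hsub

theorem store_uncommitted (h : LogAgrees s id E) (hs : StampBounds s)
    (hp : s.loc p = Local.writing v n ts) (hnew : ∀ b ∈ E, b.write ≠ some (p, id p)) :
    LogAgrees ((s.setVal p (v, ts)).setLoc p Local.written) id (E ++ batch s id E p v ts) := by
  have hval : ((s.setVal p (v, ts)).setLoc p Local.written).val p = (v, ts) := by
    simp [Config.setLoc, Config.setVal]
  have hown : ⟨some (p, id p), v, ts⟩ ∈ E ++ batch s id E p v ts := by simp [batch]
  refine ⟨⟨p, ?_, ?_⟩, ?_, ?_⟩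
  · rw [hval]
    exact h.le_of_mem_append_batch hp hnew
  · rw [hval, batch, ← List.append_assoc, List.pairwise_append]
    have hlt := h.lt_of_mem_append_overtaken hp hnew
    exact ⟨List.pairwise_of_forall_mem_list fun b hb _ _ => hlt b hb,
      List.pairwise_singleton _ _, fun b hb _ _ => hlt b hb⟩
  · exact (Function.forall_update_iff s.val fun _ c => Recorded _ c).2
      ⟨⟨_, hown, rfl, rfl⟩, fun j _ => (h.recorded j).mono (List.subset_append_left _ _)⟩
  · exact (Function.forall_update_iff s.loc fun q l => LocAgrees _ q (id q) l).2
      ⟨⟨_, hown, rfl⟩, fun q hq => h.locAgrees_append_batch_of_ne hs hp hnew hq⟩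

end LogAgrees

end Batch

end Log

/-- A committed write (or the initial value) together with the completed reads that return its
value, given by their processes and identities. -/
structure Block (n : ℕ) (V : Type*) extends LogEntry n V where
  reads : List (Fin n × ℕ)

namespace Block

/-- The operations of a block in the order in which they are linearized. -/
def ops (b : Block n V) : SeqHistory n V :=
  (b.write.toList.map fun w => SeqOp.write w.1 w.2 b.val) ++
    b.reads.map fun r => SeqOp.read r.1 r.2 b.val

/-- The block `b` with the stamp `ts` if it is the block of the write `w`. -/
def restamp (w : Fin n × ℕ) (ts : Stamp n) (b : Block n V) : Block n V :=
  { b with toLogEntry := b.toLogEntry.restamp w ts }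

/-- The block `b` with one more read at its end. -/
def addRead (b : Block n V) (p : Fin n) (k : ℕ) : Block n V :=
  { b with reads := b.reads ++ [(p, k)] }

theorem ops_restamp (w : Fin n × ℕ) (ts : Stamp n) (b : Block n V) :
    (b.restamp w ts).ops = b.ops := by
  simp only [ops, restamp, LogEntry.restamp_write, LogEntry.restamp_val]

theorem ops_addRead (b : Block n V) (p : Fin n) (k : ℕ) :
    (b.addRead p k).ops = b.ops ++ [SeqOp.read p k b.val] := by
  simp [ops, addRead]

theorem write_mem_ops_iff {b : Block n V} {p : Fin n} {k : ℕ} {v : V} :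
    SeqOp.write p k v ∈ b.ops ↔ b.write = some (p, k) ∧ b.val = v := by
  simp only [ops, List.mem_append, List.mem_map, Option.mem_toList, SeqOp.write.injEq,
    reduceCtorEq, and_false, exists_false, or_false, Prod.exists]
  constructor
  · rintro ⟨p, k, hw, rfl, rfl, rfl⟩
    exact ⟨hw, rfl⟩
  · rintro ⟨hw, rfl⟩
    exact ⟨p, k, hw, rfl, rfl, rfl⟩

end Block

/-- The block of a write that no read has returned yet. -/
def LogEntry.toBlock (b : LogEntry n V) : Block n V :=
  { b with reads := [] }

theorem LogEntry.mem_ops_toBlock {b : LogEntry n V} {e : SeqOp n V} :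
    e ∈ b.toBlock.ops ↔ ∃ w, b.write = some w ∧ e = SeqOp.write w.1 w.2 b.val := by
  simp [Block.ops, toBlock, eq_comm]

/-- The sequential history that is given by a list of blocks. -/
def seqOf (B : List (Block n V)) : SeqHistory n V :=
  B.flatMap Block.ops

section BlockLinearization

variable {H : History n V} {v₀ : V} {B B₁ B₂ : List (Block n V)} {b : Block n V} {p : Fin n}
  {k : ℕ}

theorem write_mem_seqOf_iff {v : V} :
    SeqOp.write p k v ∈ seqOf B ↔ ∃ b ∈ B, b.write = some (p, k) ∧ b.val = v := by
  simp only [seqOf, List.mem_flatMap, Block.write_mem_ops_iff]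

theorem seqOf_map_restamp (w : Fin n × ℕ) (ts : Stamp n) :
    seqOf (B.map (Block.restamp w ts)) = seqOf B := by
  simp only [seqOf, List.flatMap_map, Block.ops_restamp]

theorem seqOf_append : seqOf (B₁ ++ B₂) = seqOf B₁ ++ seqOf B₂ :=
  List.flatMap_append

theorem mem_seqOf_map_toBlock_iff {T : List (LogEntry n V)} {e : SeqOp n V} :
    e ∈ seqOf (T.map LogEntry.toBlock) ↔
      ∃ t ∈ T, ∃ w, t.write = some w ∧ e = SeqOp.write w.1 w.2 t.val := by
  simp only [seqOf, List.flatMap_map, List.mem_flatMap, LogEntry.mem_ops_toBlock]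

theorem nodup_ident_seqOf_map_toBlock {T : List (LogEntry n V)}
    (hnodup : (T.map LogEntry.write).Nodup)
    (hpend : ∀ t ∈ T, ∀ w, t.write = some w → Pending H w.1 w.2 (RegOp.write t.val)) :
    ((seqOf (T.map LogEntry.toBlock)).map SeqOp.ident).Nodup := by
  refine List.pairwise_map.2 ?_
  rw [seqOf, List.flatMap_map, List.pairwise_flatMap]
  refine ⟨fun t _ => ?_, (List.pairwise_map.1 hnodup).imp_of_mem ?_⟩
  · cases hw : t.write <;> simp [LogEntry.toBlock, Block.ops, hw]
  · intro t t' ht ht' hne e he e' he' heq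
    obtain ⟨w, hw, rfl⟩ := LogEntry.mem_ops_toBlock.1 he
    obtain ⟨w', hw', rfl⟩ := LogEntry.mem_ops_toBlock.1 he'
    have hident : w.2 = w'.2 := heq
    have hproc : w.1 = w'.1 := (hpend t ht w hw).proc_eq (hident ▸ hpend t' ht' w' hw')
    exact hne (by rw [hw, hw', Prod.ext hproc hident])

theorem seqOf_append_cons :
    seqOf (B₁ ++ b :: B₂) = seqOf B₁ ++ b.ops ++ seqOf B₂ := by
  simp [seqOf]

theorem seqOf_append_addRead_cons :
    seqOf (B₁ ++ b.addRead p k :: B₂) =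
      seqOf B₁ ++ b.ops ++ [SeqOp.read p k b.val] ++ seqOf B₂ := by
  simp [seqOf_append_cons, Block.ops_addRead]

theorem readsLast_seqOf {v : V} (hv : ∀ b ∈ B, b.write = none → b.val = v)
    (hB : B.Pairwise fun _ b => b.write ≠ none) : ReadsLast v (seqOf B) := by
  induction B generalizing v with
  | nil => trivial
  | cons b B ih =>
    obtain ⟨hb, hB⟩ := List.pairwise_cons.1 hB
    have hS : ReadsLast b.val ((b.reads.map fun r => SeqOp.read r.1 r.2 b.val) ++ seqOf B) :=
      readsLast_map_read_append_iff.2 (ih (fun b' hb' hw => absurd hw (hb b' hb')) hB)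
    cases hw : b.write with
    | none =>
      obtain rfl : b.val = v := hv b List.mem_cons_self hw
      simpa [seqOf, Block.ops, hw] using hS
    | some w => simpa [seqOf, Block.ops, hw, ReadsLast] using hS

/-- The blocks `B` give a linearization of `H` that contains no pending reads. The value `v₀` is
the one of the only block without a write. -/
structure BlockLinearization (v₀ : V) (H : History n V) (B : List (Block n V)) : Prop where
  arrangement : IsArrangement H (seqOf B)
  val_eq_of_write_eq_none : ∀ b ∈ B, b.write = none → b.val = v₀
  pairwise_write_ne_none : B.Pairwise fun _ b => b.write ≠ none
  completeIn_of_read : ∀ e ∈ seqOf B, e.op = RegOp.read → CompleteIn H e.ident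

namespace BlockLinearization

theorem nil (v₀ : V) (ts : Stamp n) : BlockLinearization v₀ [] [⟨⟨none, v₀, ts⟩, []⟩] where
  arrangement := IsArrangement.nil
  val_eq_of_write_eq_none := by simp
  pairwise_write_ne_none := List.pairwise_singleton _ _
  completeIn_of_read := by simp [seqOf, Block.ops]

theorem isLinearization (h : BlockLinearization v₀ H B) : IsLinearization v₀ H (seqOf B) :=
  h.arrangement.isLinearization
    (readsLast_seqOf h.val_eq_of_write_eq_none h.pairwise_write_ne_none)

theorem restamp (h : BlockLinearization v₀ H B) (w : Fin n × ℕ) (ts : Stamp n) :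
    BlockLinearization v₀ H (B.map (Block.restamp w ts)) where
  arrangement := by
    rw [seqOf_map_restamp]
    exact h.arrangement
  val_eq_of_write_eq_none := by
    simpa [Block.restamp, LogEntry.restamp_write, LogEntry.restamp_val] using
      h.val_eq_of_write_eq_none
  pairwise_write_ne_none := by
    simpa [List.pairwise_map, Block.restamp, LogEntry.restamp_write] using
      h.pairwise_write_ne_none
  completeIn_of_read := by
    rw [seqOf_map_restamp]
    exact h.completeIn_of_read

theorem snoc_of_forall_ne_resp (h : BlockLinearization v₀ H B) {e : Event n V}
    (he : ∀ p r, e ≠ Event.resp p r) : BlockLinearization v₀ (H ++ [e]) B where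
  arrangement := h.arrangement.snoc_of_forall_ne_resp he
  val_eq_of_write_eq_none := h.val_eq_of_write_eq_none
  pairwise_write_ne_none := h.pairwise_write_ne_none
  completeIn_of_read x hx hr := (h.completeIn_of_read x hx hr).snoc e

theorem snoc_resp_done (h : BlockLinearization v₀ H B) (hb : b ∈ B) (hw : b.write = some (p, k))
    {o : RegOp V} (hp : SolePending H p k o) :
    BlockLinearization v₀ (H ++ [Event.resp p RegResp.done]) B where
  arrangement := h.arrangement.snoc_resp (write_mem_seqOf_iff.2 ⟨b, hb, hw, rfl⟩) hp
  val_eq_of_write_eq_none := h.val_eq_of_write_eq_none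
  pairwise_write_ne_none := h.pairwise_write_ne_none
  completeIn_of_read x hx hr := (h.completeIn_of_read x hx hr).snoc _

theorem ident_ne_of_pending_read (h : BlockLinearization v₀ H B)
    (hp : Pending H p k RegOp.read) {x : SeqOp n V} (hx : x ∈ seqOf B) : x.ident ≠ k := by
  rintro rfl
  have hinv := (h.arrangement.invoked x hx).symm.trans hp.invoked
  have hop : x.proc = p ∧ x.op = RegOp.read := by simpa using hinv
  exact hp.not_completeIn (h.completeIn_of_read x hx hop.2)

theorem ident_ne_of_pending_write (h : BlockLinearization v₀ H B) {v : V}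
    (hp : Pending H p k (RegOp.write v)) (hnew : ∀ b ∈ B, b.write ≠ some (p, k))
    {x : SeqOp n V} (hx : x ∈ seqOf B) : x.ident ≠ k := by
  rintro rfl
  have hinv := (h.arrangement.invoked x hx).symm.trans hp.invoked
  cases x with
  | read q k w => simp [SeqOp.op] at hinv
  | write q k w =>
    obtain ⟨rfl, -⟩ : q = p ∧ w = v := by simpa [SeqOp.proc, SeqOp.op] using hinv
    obtain ⟨b, hb, hw, -⟩ := write_mem_seqOf_iff.1 hx
    exact hnew b hb hw

theorem snoc_resp_val (h : BlockLinearization v₀ H (B₁ ++ b :: B₂))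
    (hp : SolePending H p k RegOp.read) (hB₂ : ∀ e ∈ seqOf B₂, ¬ Precedes H e.ident k) :
    BlockLinearization v₀ (H ++ [Event.resp p (RegResp.val b.val)])
      (B₁ ++ b.addRead p k :: B₂) where
  arrangement := by
    have harr : IsArrangement H (seqOf (B₁ ++ b.addRead p k :: B₂)) := by
      rw [seqOf_append_addRead_cons]
      refine IsArrangement.insert_pending (seqOf_append_cons ▸ h.arrangement)
        (List.nodup_singleton _) (List.forall_mem_singleton.2 hp.toPending)
        (List.forall_mem_singleton.2 fun x hx => ?_) (List.forall_mem_singleton.2 hB₂)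
      exact h.ident_ne_of_pending_read hp.toPending (seqOf_append_cons ▸ hx)
    exact harr.snoc_resp (x := SeqOp.read p k b.val) (by simp [seqOf_append_addRead_cons]) hp
  val_eq_of_write_eq_none := by
    have hval := h.val_eq_of_write_eq_none
    simp only [List.forall_mem_append, List.forall_mem_cons] at hval ⊢
    exact hval
  pairwise_write_ne_none := by
    simpa [List.pairwise_append, Block.addRead] using h.pairwise_write_ne_none
  completeIn_of_read x hx hr := by
    have hx' : x ∈ seqOf (B₁ ++ b :: B₂) ∨ x = SeqOp.read p k b.val := by
      rw [seqOf_append_addRead_cons] at hx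
      rw [seqOf_append_cons]
      simp only [List.mem_append, List.mem_singleton] at hx ⊢
      tauto
    rcases hx' with hx' | rfl
    · exact (h.completeIn_of_read x hx' hr).snoc _
    · exact hp.completeIn_snoc_resp _

theorem append (h : BlockLinearization v₀ H B) {T : List (LogEntry n V)}
    (hnodup : (T.map LogEntry.write).Nodup) (hT : ∀ t ∈ T, t.write ≠ none)
    (hpend : ∀ t ∈ T, ∀ w, t.write = some w → Pending H w.1 w.2 (RegOp.write t.val))
    (hnew : ∀ t ∈ T, ∀ b ∈ B, b.write ≠ t.write) :
    BlockLinearization v₀ H (B ++ T.map LogEntry.toBlock) where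
  arrangement := by
    rw [seqOf_append, ← List.append_nil (seqOf B ++ _)]
    refine IsArrangement.insert_pending (by simpa using h.arrangement)
      (nodup_ident_seqOf_map_toBlock hnodup hpend) (fun e he => ?_) (fun e he x hx => ?_) (by simp)
    all_goals obtain ⟨t, ht, w, hw, rfl⟩ := mem_seqOf_map_toBlock_iff.1 he
    · exact hpend t ht w hw
    · exact h.ident_ne_of_pending_write (hpend t ht w hw) (fun b hb => hw ▸ hnew t ht b hb)
        (by simpa using hx)
  val_eq_of_write_eq_none b hb hw := by
    rcases List.mem_append.1 hb with hb | hb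
    · exact h.val_eq_of_write_eq_none b hb hw
    · obtain ⟨t, ht, rfl⟩ := List.mem_map.1 hb
      exact absurd hw (hT t ht)
  pairwise_write_ne_none := by
    have hT' : ∀ b ∈ T.map LogEntry.toBlock, b.write ≠ none := List.forall_mem_map.2 hT
    exact List.pairwise_append.2 ⟨h.pairwise_write_ne_none,
      List.pairwise_of_forall_mem_list fun _ _ b hb => hT' b hb, fun _ _ b hb => hT' b hb⟩
  completeIn_of_read x hx hr := by
    rw [seqOf_append] at hx
    rcases List.mem_append.1 hx with hx | hx
    · exact h.completeIn_of_read x hx hr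
    · obtain ⟨t, -, w, -, rfl⟩ := mem_seqOf_map_toBlock_iff.1 hx
      cases hr

end BlockLinearization

end BlockLinearization

section ReadFloor

variable {H : History n V} {val val' : Fin n → Cell n V} {B B₁ B₂ : List (Block n V)}
  {b : Block n V} {cs : List (Cell n V)} {i j p : Fin n} {k k' : ℕ}

/-- The tuple that a read which has collected the tuples `cs` obtains from `Val[j]`: the one that
it has collected, or else the current contents of `Val[j]`. -/
def collected (val : Fin n → Cell n V) (cs : List (Cell n V)) (j : Fin n) : Cell n V :=
  cs[(j : ℕ)]?.getD (val j)

theorem collected_append_singleton (hi : cs.length = i) :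
    collected val (cs ++ [val i]) j = collected val cs j := by
  rcases lt_trichotomy (j : ℕ) i with hj | hj | hj
  · rw [collected, collected, List.getElem?_append_left (hi ▸ hj)]
  · obtain rfl := Fin.ext hj
    simp [collected, ← hi]
  · rw [collected, collected, List.getElem?_eq_none (by simp; omega),
      List.getElem?_eq_none (by omega)]

theorem collected_mem (hlen : cs.length = n) : collected val cs j ∈ cs := by
  simp [collected, hlen]

theorem collected_mono (hval : ∀ j, toLex (val j).2 ≤ toLex (val' j).2) :
    toLex (collected val cs j).2 ≤ toLex (collected val' cs j).2 := by
  unfold collected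
  cases cs[(j : ℕ)]?
  · exact hval j
  · exact le_rfl

/-- The read with identity `k`, which has collected the tuples `cs`, can be linearized at the end
of each block whose stamp is at least the one obtained from a suitable `Val[j]`: no operation of a
later block precedes the read. -/
def ReadFloor (H : History n V) (val : Fin n → Cell n V) (B : List (Block n V))
    (cs : List (Cell n V)) (k : ℕ) : Prop :=
  ∃ j, B.Pairwise fun b b' => toLex (collected val cs j).2 ≤ toLex b.stamp →
    ∀ e ∈ b'.ops, ¬ Precedes H e.ident k

namespace ReadFloor

theorem of_top (h : B.Pairwise fun b _ => toLex b.stamp < toLex (val j).2) :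
    ReadFloor H val B [] k :=
  ⟨j, h.imp fun hlt hle => absurd hlt hle.not_gt⟩

theorem not_precedes (h : ReadFloor H val (B₁ ++ b :: B₂) cs k) (hlen : cs.length = n)
    (hb : ∀ c ∈ cs, toLex c.2 ≤ toLex b.stamp) : ∀ e ∈ seqOf B₂, ¬ Precedes H e.ident k := by
  obtain ⟨j, hB⟩ := h
  intro e he
  obtain ⟨b', hb', heb'⟩ := List.mem_flatMap.1 he
  exact (List.pairwise_cons.1 (List.pairwise_append.1 hB).2.1).1 b' hb'
    (hb _ (collected_mem hlen)) e heb'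

theorem snoc (h : ReadFloor H val B cs k) (hk : k ≤ H.length) (e : Event n V) :
    ReadFloor (H ++ [e]) val B cs k :=
  h.imp fun _ => List.Pairwise.imp fun hB hle x hx => by
    rw [precedes_snoc_iff hk]
    exact hB hle x hx

theorem mono (h : ReadFloor H val B cs k) (hval : ∀ j, toLex (val j).2 ≤ toLex (val' j).2) :
    ReadFloor H val' B cs k :=
  h.imp fun _ => List.Pairwise.imp fun hB hle => hB ((collected_mono hval).trans hle)

theorem scan (h : ReadFloor H val B cs k) (hi : cs.length = i) :
    ReadFloor H val B (cs ++ [val i]) k := by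
  simpa only [ReadFloor, collected_append_singleton hi] using h

theorem restamp (h : ReadFloor H val B cs k) {w : Fin n × ℕ} {ts : Stamp n}
    (hle : ∀ b ∈ B, toLex (b.restamp w ts).stamp ≤ toLex b.stamp) :
    ReadFloor H val (B.map (Block.restamp w ts)) cs k := by
  obtain ⟨j, hB⟩ := h
  refine ⟨j, List.pairwise_map.2 (hB.imp_of_mem fun hb _ hbb' hj => ?_)⟩
  rw [Block.ops_restamp]
  exact hbb' (hj.trans (hle _ hb))

theorem append (h : ReadFloor H val B cs k)
    (hB₂ : ∀ b ∈ B₂, ∀ e ∈ b.ops, ¬ Precedes H e.ident k) : ReadFloor H val (B ++ B₂) cs k := by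
  obtain ⟨j, hB⟩ := h
  exact ⟨j, List.pairwise_append.2 ⟨hB, List.pairwise_of_forall_mem_list
    fun _ _ b hb _ => hB₂ b hb, fun _ _ b hb _ => hB₂ b hb⟩⟩

theorem addRead (h : ReadFloor H val (B₁ ++ b :: B₂) cs k) (hk' : ¬ Precedes H k' k) :
    ReadFloor H val (B₁ ++ b.addRead p k' :: B₂) cs k := by
  obtain ⟨j, hB⟩ := h
  have hops : (∀ e ∈ b.ops, ¬ Precedes H e.ident k) →
      ∀ e ∈ (b.addRead p k').ops, ¬ Precedes H e.ident k := by
    rw [Block.ops_addRead]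
    exact fun hb => List.forall_mem_append.2 ⟨hb, List.forall_mem_singleton.2 hk'⟩
  rw [List.pairwise_append, List.pairwise_cons] at hB
  obtain ⟨hB₁, ⟨hb, hB₂⟩, hB₁₂⟩ := hB
  refine ⟨j, List.pairwise_append.2 ⟨hB₁, List.pairwise_cons.2 ⟨hb, hB₂⟩, fun b₁ hb₁ => ?_⟩⟩
  exact List.forall_mem_cons.2 ⟨fun hj => hops (hB₁₂ b₁ hb₁ b List.mem_cons_self hj),
    fun b' hb' => hB₁₂ b₁ hb₁ b' (List.mem_cons_of_mem b hb')⟩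

end ReadFloor

end ReadFloor

section Simulation

variable {H : History n V} {s : Config n V} {id : Fin n → ℕ} {B B₁ B₂ : List (Block n V)}
  {b : Block n V} {p : Fin n} {k : ℕ} {v₀ v : V} {ts : Stamp n} {cs : List (Cell n V)}

/-- Every active read satisfies `ReadFloor`. -/
def ReadFloors (H : History n V) (s : Config n V) (id : Fin n → ℕ) (B : List (Block n V)) : Prop :=
  ∀ q cs, s.loc q = Local.reading cs → ReadFloor H s.val B cs (id q)

namespace ReadFloors

theorem setLoc_update (h : ReadFloors H s id B) {l : Local n V}
    (hl : ∀ cs, l = Local.reading cs → ReadFloor H s.val B cs k) :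
    ReadFloors H (s.setLoc p l) (Function.update id p k) B := by
  intro q cs hq
  rcases eq_or_ne q p with rfl | hqp
  · simpa [Config.setLoc] using hl cs (by simpa [Config.setLoc] using hq)
  · simpa [Config.setLoc, hqp] using h q cs (by simpa [Config.setLoc, hqp] using hq)

theorem setLoc (h : ReadFloors H s id B) {l : Local n V}
    (hl : ∀ cs, l = Local.reading cs → ReadFloor H s.val B cs (id p)) :
    ReadFloors H (s.setLoc p l) id B := by
  simpa using h.setLoc_update (p := p) hl

theorem snoc (h : ReadFloors H s id B) (ht : Tracks H s.loc id) (e : Event n V) :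
    ReadFloors (H ++ [e]) s id B :=
  fun q cs hq => (h q cs hq).snoc (ht.of_reading hq).lt_length.le e

theorem setVal (h : ReadFloors H s id B) {c : Cell n V} (hc : (s.val p).2 ≤ c.2) :
    ReadFloors H (s.setVal p c) id B := by
  refine fun q cs hq => (h q cs hq).mono fun j => ?_
  rcases eq_or_ne j p with rfl | hj
  · simpa [Config.setVal] using Pi.toLex_monotone hc
  · simp [Config.setVal, hj]

end ReadFloors

/-- The invariant of the linearization: after the history `H`, which leads to the configuration
`s`, the operations are linearized as in the blocks `B`. The last operation that process `p` has
invoked is `id p`. -/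
structure Simulates (v₀ : V) (H : History n V) (s : Config n V) (id : Fin n → ℕ)
    (B : List (Block n V)) : Prop where
  bounds : StampBounds s
  tracks : Tracks H s.loc id
  agrees : LogAgrees s id (B.map Block.toLogEntry)
  linearization : BlockLinearization v₀ H B
  floors : ReadFloors H s id B

namespace Simulates

theorem init (v₀ : V) (hn : 0 < n) (id : Fin n → ℕ) :
    Simulates v₀ [] (Config.init n v₀) id [⟨⟨none, v₀, fun _ => 0⟩, []⟩] where
  bounds := StampBounds.init v₀
  tracks := Tracks.nil
  agrees := LogAgrees.init v₀ hn id
  linearization := BlockLinearization.nil v₀ _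
  floors q cs hq := by cases hq

theorem write_ne_length (h : Simulates v₀ H s id B) {b : LogEntry n V}
    (hb : b ∈ B.map Block.toLogEntry) : b.write ≠ some (p, H.length) := by
  intro hw
  obtain ⟨b', hb', rfl⟩ := List.mem_map.1 hb
  exact (h.linearization.arrangement.ident_lt_length
    (write_mem_seqOf_iff.2 ⟨b', hb', hw, rfl⟩)).false

theorem invWrite (h : Simulates v₀ H s id B) (hp : s.loc p = Local.idle) (v : V) :
    Simulates v₀ (H ++ [Event.inv p (RegOp.write v)])
      (s.setLoc p (Local.writing v 0 fun _ => ⊤)) (Function.update id p H.length) B where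
  bounds := h.bounds.step (Step.invWrite s p v hp)
  tracks := h.tracks.snoc_update (e := Event.inv p (RegOp.write v))
    ((h.tracks.quiescent hp).snoc_inv _)
  agrees := h.agrees.invWrite h.bounds (fun _ => h.write_ne_length) v
  linearization := h.linearization.snoc_of_forall_ne_resp (by simp)
  floors := (h.floors.snoc h.tracks _).setLoc_update (by simp)

theorem invRead (h : Simulates v₀ H s id B) (hp : s.loc p = Local.idle) :
    Simulates v₀ (H ++ [Event.inv p RegOp.read]) (s.setLoc p (Local.reading []))
      (Function.update id p H.length) B where
  bounds := h.bounds.step (Step.invRead s p hp)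
  tracks := h.tracks.snoc_update (e := Event.inv p RegOp.read)
    ((h.tracks.quiescent hp).snoc_inv _)
  agrees := h.agrees.setLoc_update fun c hc => absurd hc List.not_mem_nil
  linearization := h.linearization.snoc_of_forall_ne_resp (by simp)
  floors := by
    refine (h.floors.snoc h.tracks _).setLoc_update fun cs hcs => ?_
    obtain rfl : [] = cs := by simpa using hcs
    obtain ⟨j, -, hj⟩ := h.agrees.top
    exact ReadFloor.of_top (List.pairwise_map.1 hj)

theorem readScan {i : Fin n} (h : Simulates v₀ H s id B) (hp : s.loc p = Local.reading cs)
    (hi : cs.length = i) : Simulates v₀ (H ++ [Event.baseRead p i (s.val i)])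
      (s.setLoc p (Local.reading (cs ++ [s.val i]))) id B where
  bounds := h.bounds.step (Step.readScan s p i cs hp hi)
  tracks := h.tracks.snoc_update_loc (e := Event.baseRead p i (s.val i))
    ((h.tracks.of_reading hp).snoc (by simp) (by simp))
  agrees := h.agrees.setLoc <| List.forall_mem_append.2
    ⟨h.agrees.reading hp, List.forall_mem_singleton.2 (h.agrees.recorded i)⟩
  linearization := h.linearization.snoc_of_forall_ne_resp (by simp)
  floors := by
    have hfloors := h.floors.snoc h.tracks (Event.baseRead p i (s.val i))
    refine hfloors.setLoc fun cs' hcs' => ?_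
    obtain rfl : cs ++ [s.val i] = cs' := by simpa using hcs'
    exact (hfloors p cs hp).scan hi

theorem writeScan {i : Fin n} (h : Simulates v₀ H s id B) (hp : s.loc p = Local.writing v i ts) :
    Simulates v₀ (H ++ [Event.baseRead p i (s.val i)])
      (s.setLoc p (Local.writing v (i + 1) (scanStamp s p i ts))) id
      (B.map (Block.restamp (p, id p) (scanStamp s p i ts))) where
  bounds := h.bounds.scan hp
  tracks := h.tracks.snoc_update_loc (e := Event.baseRead p i (s.val i))
    ((h.tracks.of_writing hp).snoc (by simp) (by simp))
  agrees := by
    simpa [Function.comp_def, Block.restamp] using h.agrees.scan h.bounds hp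
  linearization := (h.linearization.restamp _ _).snoc_of_forall_ne_resp (by simp)
  floors := by
    have hfloors : ReadFloors H s id (B.map (Block.restamp (p, id p) (scanStamp s p i ts))) :=
      fun q cs hq => (h.floors q cs hq).restamp fun b hb =>
        h.agrees.restamp_le h.bounds hp (List.mem_map_of_mem hb)
    exact (hfloors.snoc h.tracks _).setLoc (by simp)

theorem writeStore_committed (h : Simulates v₀ H s id B) (hp : s.loc p = Local.writing v n ts)
    {b : LogEntry n V} (hb : b ∈ B.map Block.toLogEntry) (hw : b.write = some (p, id p)) :
    Simulates v₀ (H ++ [Event.baseWrite p (v, ts)])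
      ((s.setVal p (v, ts)).setLoc p Local.written) id B where
  bounds := h.bounds.store hp
  tracks := h.tracks.snoc_update_loc (e := Event.baseWrite p (v, ts))
    ⟨v, (h.tracks.of_writing hp).snoc (by simp) (by simp)⟩
  agrees := h.agrees.store_committed h.bounds hp hb hw
  linearization := h.linearization.snoc_of_forall_ne_resp (by simp)
  floors := ((h.floors.snoc h.tracks _).setVal (h.bounds.val_le hp)).setLoc (by simp)

theorem pending_of_mem_batch (h : Simulates v₀ H s id B) (hp : s.loc p = Local.writing v n ts)
    (hnew : ∀ b ∈ B.map Block.toLogEntry, b.write ≠ some (p, id p)) {t : LogEntry n V}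
    (ht : t ∈ batch s id (B.map Block.toLogEntry) p v ts) {w : Fin n × ℕ}
    (hw : t.write = some w) : Pending H w.1 w.2 (RegOp.write t.val) := by
  obtain ⟨q, v', i, ts', hq, rfl, -⟩ := exists_of_mem_batch hp hnew ht
  obtain rfl : (q, id q) = w := by simpa using hw
  exact (h.tracks.of_writing hq).toPending

theorem linearization_append_batch (h : Simulates v₀ H s id B)
    (hp : s.loc p = Local.writing v n ts)
    (hnew : ∀ b ∈ B.map Block.toLogEntry, b.write ≠ some (p, id p)) :
    BlockLinearization v₀ H
      (B ++ (batch s id (B.map Block.toLogEntry) p v ts).map LogEntry.toBlock) := by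
  refine h.linearization.append (nodup_batch_map_write hp) (fun t ht => ?_)
    (fun t ht w => h.pending_of_mem_batch hp hnew ht) fun t ht b hb => ?_
  all_goals obtain ⟨q, v', i, ts', -, rfl, hnew'⟩ := exists_of_mem_batch hp hnew ht
  · simp
  · exact hnew' b.toLogEntry (List.mem_map_of_mem hb)

theorem floors_append_batch (h : Simulates v₀ H s id B) (hp : s.loc p = Local.writing v n ts)
    (hnew : ∀ b ∈ B.map Block.toLogEntry, b.write ≠ some (p, id p)) :
    ReadFloors H s id
      (B ++ (batch s id (B.map Block.toLogEntry) p v ts).map LogEntry.toBlock) := by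
  refine fun q cs hq => (h.floors q cs hq).append (List.forall_mem_map.2 fun t ht e he hek => ?_)
  obtain ⟨w, hw, rfl⟩ := LogEntry.mem_ops_toBlock.1 he
  exact (h.pending_of_mem_batch hp hnew ht hw).not_completeIn hek.completeIn

theorem writeStore_uncommitted (h : Simulates v₀ H s id B) (hp : s.loc p = Local.writing v n ts)
    (hnew : ∀ b ∈ B.map Block.toLogEntry, b.write ≠ some (p, id p)) :
    Simulates v₀ (H ++ [Event.baseWrite p (v, ts)])
      ((s.setVal p (v, ts)).setLoc p Local.written) id
      (B ++ (batch s id (B.map Block.toLogEntry) p v ts).map LogEntry.toBlock) where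
  bounds := h.bounds.store hp
  tracks := h.tracks.snoc_update_loc (e := Event.baseWrite p (v, ts))
    ⟨v, (h.tracks.of_writing hp).snoc (by simp) (by simp)⟩
  agrees := by
    simpa [Function.comp_def, LogEntry.toBlock] using h.agrees.store_uncommitted h.bounds hp hnew
  linearization := (h.linearization_append_batch hp hnew).snoc_of_forall_ne_resp (by simp)
  floors := (((h.floors_append_batch hp hnew).snoc h.tracks _).setVal
    (h.bounds.val_le hp)).setLoc (by simp)

theorem writeReturn (h : Simulates v₀ H s id B) (hp : s.loc p = Local.written) :
    Simulates v₀ (H ++ [Event.resp p RegResp.done]) (s.setLoc p Local.idle) id B where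
  bounds := h.bounds.step (Step.writeReturn s p hp)
  tracks := by
    obtain ⟨v, hpend⟩ := h.tracks.of_written hp
    exact h.tracks.snoc_update_loc (e := Event.resp p RegResp.done) (hpend.snoc_resp _)
  agrees := h.agrees.setLoc trivial
  linearization := by
    obtain ⟨v, hpend⟩ := h.tracks.of_written hp
    have hwritten := h.agrees.loc p
    simp only [hp, LocAgrees, List.mem_map, exists_exists_and_eq_and] at hwritten
    obtain ⟨b, hb, hw⟩ := hwritten
    exact h.linearization.snoc_resp_done hb hw hpend
  floors := (h.floors.snoc h.tracks _).setLoc (by simp)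

theorem readReturn (h : Simulates v₀ H s id (B₁ ++ b :: B₂)) (hp : s.loc p = Local.reading cs)
    (hlen : cs.length = n) (hmax : ∀ c ∈ cs, toLex c.2 ≤ toLex b.stamp) :
    Simulates v₀ (H ++ [Event.resp p (RegResp.val b.val)]) (s.setLoc p Local.idle) id
      (B₁ ++ b.addRead p (id p) :: B₂) where
  bounds := h.bounds.setLoc trivial
  tracks := h.tracks.snoc_update_loc (e := Event.resp p _) ((h.tracks.of_reading hp).snoc_resp _)
  agrees := by
    simpa [Block.addRead] using h.agrees.setLoc (l := Local.idle) trivial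
  linearization := h.linearization.snoc_resp_val (h.tracks.of_reading hp)
    ((h.floors p cs hp).not_precedes hlen hmax)
  floors := by
    have hfloors : ReadFloors H s id (B₁ ++ b.addRead p (id p) :: B₂) := fun q cs' hq =>
      (h.floors q cs' hq).addRead fun hpq =>
        (h.tracks.of_reading hp).not_completeIn hpq.completeIn
    exact (hfloors.snoc h.tracks _).setLoc (by simp)

theorem step (h : Simulates v₀ H s id B) {e : Event n V} {s' : Config n V} (hs : Step s e s') :
    ∃ id' B', Simulates v₀ (H ++ [e]) s' id' B' ∧
      (seqOf B).filter SeqOp.isWrite <+: (seqOf B').filter SeqOp.isWrite := by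
  cases hs with
  | invWrite p v hp => exact ⟨_, B, h.invWrite hp v, List.prefix_rfl⟩
  | writeScan p v i ts hp =>
    exact ⟨id, _, h.writeScan hp, by rw [seqOf_map_restamp]⟩
  | writeStore p v ts hp =>
    by_cases hnew : ∀ b ∈ B.map Block.toLogEntry, b.write ≠ some (p, id p)
    · refine ⟨id, _, h.writeStore_uncommitted hp hnew, ?_⟩
      rw [seqOf_append, List.filter_append]
      exact List.prefix_append _ _
    · push Not at hnew
      obtain ⟨b, hb, hw⟩ := hnew
      exact ⟨id, B, h.writeStore_committed hp hb hw, List.prefix_rfl⟩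
  | writeReturn p hp => exact ⟨id, B, h.writeReturn hp, List.prefix_rfl⟩
  | invRead p hp => exact ⟨_, B, h.invRead hp, List.prefix_rfl⟩
  | readScan p i cs hp hi => exact ⟨id, B, h.readScan hp hi, List.prefix_rfl⟩
  | readReturn p cs c hp hlen hc hmax =>
    obtain ⟨b', hb', hval, hstamp⟩ := h.agrees.reading hp c hc
    obtain ⟨b, hb, rfl⟩ := List.mem_map.1 hb'
    obtain ⟨B₁, B₂, rfl⟩ := List.append_of_mem hb
    refine ⟨id, _, hval ▸ h.readReturn hp hlen (hstamp ▸ hmax), ?_⟩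
    simp [seqOf_append_cons, Block.ops_addRead, SeqOp.isWrite]

end Simulates

theorem exists_simulates_snoc (h : ∀ s, Run v₀ H s → ∃ id, Simulates v₀ H s id B)
    (e : Event n V) :
    ∃ B', (seqOf B).filter SeqOp.isWrite <+: (seqOf B').filter SeqOp.isWrite ∧
      ∀ s, Run v₀ (H ++ [e]) s → ∃ id, Simulates v₀ (H ++ [e]) s id B' := by
  by_cases hrun : ∃ s s', Run v₀ H s ∧ Step s e s'
  · obtain ⟨s, s', hs, hstep⟩ := hrun
    obtain ⟨id, hsim⟩ := h s hs
    obtain ⟨id', B', hsim', hprefix⟩ := hsim.step hstep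
    exact ⟨B', hprefix, fun s'' hs'' => ⟨id', hs''.unique (hs.snoc hstep) ▸ hsim'⟩⟩
  · refine ⟨B, List.prefix_rfl, fun s' hs' => absurd ?_ hrun⟩
    obtain ⟨s, hs, hstep⟩ := hs'.exists_of_snoc
    exact ⟨s, s', hs, hstep⟩

theorem writeStronglyLinearizable_histories (v₀ : V) (hn : 0 < n) :
    WriteStronglyLinearizable v₀ (histories n v₀) := by
  obtain ⟨f, hf, hprefix⟩ := exists_forall_prefix_rel
    (P := fun H B => ∀ s, Run v₀ H s → ∃ id, Simulates v₀ H s id B)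
    (r := Order.Preimage (fun B => (seqOf B).filter SeqOp.isWrite) (· <+: ·))
    (fun s hs => ⟨fun _ => 0, hs.unique Run.nil ▸ Simulates.init v₀ hn _⟩)
    (fun _ _ => exists_simulates_snoc)
  refine ⟨fun H => seqOf (f H), fun H ⟨s, hs⟩ => ?_, fun G _ H _ => hprefix G H⟩
  obtain ⟨id, h⟩ := hf H s hs
  exact h.linearization.isLinearization

end Simulation

section NotStrong

variable {v₀ v : V} {H G : History n V} {s : Config n V} {p p₁ p₂ p₃ : Fin n}

/-- An access to a shared register. -/
def IsAccess : Event n V → Prop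
  | Event.baseRead _ _ _ => True
  | Event.baseWrite _ _ => True
  | _ => False

theorem setLoc_loc_self (s : Config n V) (p : Fin n) (l : Local n V) :
    (s.setLoc p l).loc p = l := by
  simp [Config.setLoc]

theorem setLoc_setLoc (s : Config n V) (p : Fin n) (l l' : Local n V) :
    (s.setLoc p l).setLoc p l' = s.setLoc p l' := by
  simp [Config.setLoc]

theorem exists_run_writeLoop (h : Run v₀ H s) (v : V) (hp : s.loc p = Local.idle) {k : ℕ}
    (hk : k ≤ n) :
    ∃ L ts, Run v₀ (H ++ Event.inv p (RegOp.write v) :: L) (s.setLoc p (Local.writing v k ts)) ∧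
      ∀ e ∈ L, IsAccess e := by
  induction k with
  | zero => exact ⟨[], _, h.snoc (Step.invWrite s p v hp), by simp⟩
  | succ k ih =>
    obtain ⟨L, ts, hrun, hL⟩ := ih (by omega)
    have hstep := Step.writeScan (s.setLoc p (Local.writing v k ts)) p v ⟨k, hk⟩ ts
      (setLoc_loc_self _ _ _)
    rw [setLoc_setLoc] at hstep
    exact ⟨L ++ [Event.baseRead _ _ _], _, by simpa using hrun.snoc hstep,
      List.forall_mem_append.2 ⟨hL, List.forall_mem_singleton.2 trivial⟩⟩

theorem exists_run_write (h : Run v₀ H s) (v : V) (hp : s.loc p = Local.idle) :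
    ∃ L s' ts, Run v₀ (H ++ Event.inv p (RegOp.write v) :: L) s' ∧
      CompleteIn (H ++ Event.inv p (RegOp.write v) :: L) H.length ∧
      (∀ q o, Event.inv q o ∉ L) ∧ (∀ q, q ≠ p → ∀ r, Event.resp q r ∉ L) ∧
      s'.loc = s.loc ∧ s'.val = Function.update s.val p (v, ts) := by
  obtain ⟨L, ts, hloop, hL⟩ := exists_run_writeLoop h v hp le_rfl
  have hstore := hloop.snoc (Step.writeStore _ p v ts (setLoc_loc_self _ _ _))
  have hreturn := hstore.snoc (Step.writeReturn _ p (setLoc_loc_self _ _ _))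
  have hinv : ∀ q o, Event.inv q o ∉ L := fun q o he => hL _ he
  have hresp : ∀ q r, Event.resp q r ∉ L := fun q r he => hL _ he
  have hpend : Pending (H ++ [Event.inv p (RegOp.write v)] ++ (L ++ [Event.baseWrite p (v, ts)])) p
      H.length (RegOp.write v) :=
    (Pending.snoc_inv H p _).append (by simp [hresp])
  refine ⟨L ++ [Event.baseWrite p (v, ts), Event.resp p RegResp.done], _, ts,
    by simpa using hreturn, by simpa using hpend.completeIn_snoc_resp RegResp.done,
    by simp [hinv], fun q hq => by simp [hresp, hq], ?_, ?_⟩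
  · simp [Config.setLoc, Config.setVal, ← hp]
  · simp [Config.setLoc, Config.setVal]

theorem exists_run_readLoop (h : Run v₀ H s) {cs : List (Cell n V)}
    (hp : s.loc p = Local.reading cs) {k : ℕ} (hk : cs.length + k ≤ n) :
    ∃ L cs', Run v₀ (H ++ L) (s.setLoc p (Local.reading cs')) ∧ (∀ e ∈ L, IsAccess e) ∧
      cs'.length = cs.length + k ∧
      ∀ c, c ∈ cs' ↔ c ∈ cs ∨ ∃ i : Fin n, cs.length ≤ i ∧ i < cs.length + k ∧ s.val i = c := by
  induction k with
  | zero =>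
    refine ⟨[], cs, ?_, by simp, rfl, fun c => ?_⟩
    · simpa [Config.setLoc, ← hp] using h
    · exact ⟨Or.inl, fun hc => hc.resolve_right fun ⟨i, hi, hi', _⟩ => hi.not_gt hi'⟩
  | succ k ih =>
    obtain ⟨L, cs', hrun, hL, hlen, hmem⟩ := ih (by omega)
    have hstep := Step.readScan (s.setLoc p (Local.reading cs')) p ⟨cs.length + k, by omega⟩ cs'
      (setLoc_loc_self _ _ _) hlen
    rw [setLoc_setLoc] at hstep
    refine ⟨L ++ [Event.baseRead _ _ _], _, by simpa using hrun.snoc hstep,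
      List.forall_mem_append.2 ⟨hL, List.forall_mem_singleton.2 trivial⟩,
      by simp [hlen, add_assoc], fun c => ?_⟩
    rw [List.mem_append, List.mem_singleton, hmem, or_assoc]
    refine or_congr_right ⟨?_, ?_⟩
    · rintro (⟨i, hi, hik, hc⟩ | rfl)
      · exact ⟨i, hi, by omega, hc⟩
      · exact ⟨⟨cs.length + k, by omega⟩, by simp, by simp, rfl⟩
    · rintro ⟨i, hi, hik, rfl⟩
      rcases Nat.lt_succ_iff_lt_or_eq.1 hik with hik | hik
      · exact Or.inl ⟨i, hi, hik, rfl⟩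
      · exact Or.inr (congrArg s.val (Fin.ext hik))

theorem exists_respondsAt_of_reading (h : Run v₀ H s) {cs : List (Cell n V)}
    (hp : s.loc p = Local.reading cs) (hlen : cs.length ≤ n) {k : ℕ} {o : RegOp V}
    (hpend : Pending H p k o) {c : Cell n V}
    (hc : c ∈ cs ∨ ∃ i : Fin n, cs.length ≤ i ∧ s.val i = c)
    (hcs : ∀ c' ∈ cs, c'.2 ≤ c.2) (hval : ∀ i : Fin n, cs.length ≤ i → (s.val i).2 ≤ c.2) :
    ∃ L m, H ++ L ∈ histories n v₀ ∧ (∀ q o, Event.inv q o ∉ L) ∧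
      RespondsAt (H ++ L) k m (RegResp.val c.1) := by
  obtain ⟨L, cs', hloop, hL, hlen', hmem⟩ :=
    exists_run_readLoop h hp (k := n - cs.length) (by omega)
  have hreturn := hloop.snoc (e := Event.resp p (RegResp.val c.1)) <|
    Step.readReturn _ p cs' c (setLoc_loc_self _ _ _) (by omega) ?_ fun c' hc' => ?_
  · refine ⟨L ++ [Event.resp p (RegResp.val c.1)], (H ++ L).length, ⟨_, by simpa using hreturn⟩,
      fun q o he => ?_, ?_⟩
    · exact hL _ (by simpa using he)
    · rw [← List.append_assoc]
      exact respondsAt_snoc_iff.2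
        (Or.inr ⟨rfl, p, o, rfl, hpend.append fun r hr => hL _ hr⟩)
  · exact (hmem c).2 (hc.imp_right fun ⟨i, hi, hic⟩ => ⟨i, hi, by omega, hic⟩)
  · rcases (hmem c').1 hc' with hc' | ⟨i, hi, -, rfl⟩
    · exact Pi.toLex_monotone (hcs c' hc')
    · exact Pi.toLex_monotone (hval i hi)

/-- The history `G`, which leads to the configuration `s`, ends while a read by `p₃` has collected
only the initial contents of the first register `Val[p₁]`; meanwhile `p₁` has completed a write of
`v`, invoked at position `2`. All executions that refute strong linearizability extend `G`. -/
structure StaleRead (v₀ v : V) (G : History n V) (s : Config n V) (p₁ p₃ : Fin n) : Prop where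
  run : Run v₀ G s
  invoked : G[2]? = some (Event.inv p₁ (RegOp.write v))
  complete : CompleteIn G 2
  pending : Pending G p₃ 0 RegOp.read
  eq_of_write : ∀ q u, Event.inv q (RegOp.write u) ∈ G → u = v
  loc : s.loc = Function.update (fun _ => Local.idle) p₃ (Local.reading [(v₀, fun _ => 0)])
  val : ∀ i : Fin n, 1 ≤ (i : ℕ) → s.val i = (v₀, fun _ => 0)

theorem exists_staleRead (v₀ v : V) (h₁ : (p₁ : ℕ) = 0) (h₁₃ : p₁ ≠ p₃) :
    ∃ G s, StaleRead v₀ v G s p₁ p₃ := by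
  have hinv := (Run.nil (n := n) (v₀ := v₀)).snoc (Step.invRead _ p₃ rfl)
  have hscan := hinv.snoc (Step.readScan _ p₃ p₁ [] (setLoc_loc_self _ _ _) h₁.symm)
  rw [setLoc_setLoc] at hscan
  obtain ⟨L, s, ts, hrun, hcomplete, hinvL, hrespL, hloc, hval⟩ :=
    exists_run_write hscan v (p := p₁) (by simp [Config.setLoc, Config.init, h₁₃])
  refine ⟨_, s, hrun, rfl, hcomplete, ?_, fun q u hu => ?_, hloc.trans rfl, fun i hi => ?_⟩
  · exact (Pending.snoc_inv [] p₃ RegOp.read).append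
      (L := Event.baseRead p₃ p₁ _ :: Event.inv p₁ (RegOp.write v) :: L)
      (by simp [hrespL p₃ h₁₃.symm])
  · simp only [List.nil_append, List.cons_append, List.mem_cons, Event.inv.injEq, reduceCtorEq,
      RegOp.write.injEq, and_false, false_or, hinvL, or_false] at hu
    exact hu.2
  · have hi₁ : i ≠ p₁ := by rintro rfl; omega
    rw [hval, Function.update_of_ne hi₁]
    rfl

namespace StaleRead

theorem reading (h : StaleRead v₀ v G s p₁ p₃) :
    s.loc p₃ = Local.reading [(v₀, fun _ => 0)] := by
  simp [h.loc]

theorem exists_respondsAt_initial (h : StaleRead v₀ v G s p₁ p₃) (hv : v ≠ v₀) :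
    ∃ A m, A ∈ histories n v₀ ∧ G <+: A ∧ (∀ q, Event.inv q (RegOp.write v₀) ∉ A) ∧
      RespondsAt A 0 m (RegResp.val v₀) := by
  obtain ⟨L, m, hmem, hinv, hresp⟩ := exists_respondsAt_of_reading h.run h.reading
    p₁.pos h.pending (Or.inl (List.mem_singleton_self _)) (by simp)
    fun i hi => (congrArg Prod.snd (h.val i hi)).le
  refine ⟨G ++ L, m, hmem, List.prefix_append _ _, fun q hq => ?_, hresp⟩
  rcases List.mem_append.1 hq with hq | hq
  · exact hv (h.eq_of_write q v₀ hq).symm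
  · exact hinv q _ hq

theorem exists_respondsAt_written (h : StaleRead v₀ v G s p₁ p₃) (h₂ : 1 ≤ (p₂ : ℕ))
    (h₂₃ : p₂ ≠ p₃) :
    ∃ B m, B ∈ histories n v₀ ∧ G <+: B ∧ RespondsAt B 0 m (RegResp.val v) := by
  obtain ⟨L, s', ts, hrun, -, -, hresp, hloc, hval⟩ :=
    exists_run_write h.run v (p := p₂) (by simp [h.loc, h₂₃])
  have hpend : Pending (G ++ Event.inv p₂ (RegOp.write v) :: L) p₃ 0 RegOp.read :=
    h.pending.append (by simp [hresp p₃ h₂₃.symm])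
  have hle : ∀ i : Fin n, 1 ≤ (i : ℕ) → (s'.val i).2 ≤ ts := fun i hi => by
    rcases eq_or_ne i p₂ with rfl | hi₂
    · simp [hval]
    · rw [hval, Function.update_of_ne hi₂, h.val i hi]
      exact fun _ => bot_le
  obtain ⟨L', m, hmem, -, hm⟩ := exists_respondsAt_of_reading hrun
    ((congrFun hloc p₃).trans h.reading) p₂.pos hpend (c := (v, ts))
    (Or.inr ⟨p₂, h₂, by simp [hval]⟩) (by simp [Pi.le_def]) hle
  exact ⟨_, m, hmem, ⟨_, (List.append_assoc _ _ _).symm⟩, hm⟩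

end StaleRead

theorem not_stronglyLinearizable_histories [Nontrivial V] (v₀ : V) (hn : 3 ≤ n) :
    ¬ StronglyLinearizable v₀ (histories n v₀) := by
  obtain ⟨v, hv⟩ := exists_ne v₀
  obtain ⟨G, s, h⟩ := exists_staleRead (p₁ := (⟨0, by omega⟩ : Fin n))
    (p₃ := (⟨2, by omega⟩ : Fin n)) v₀ v rfl (by simp)
  obtain ⟨A, m, hA, hGA, hv₀, hAm⟩ := h.exists_respondsAt_initial hv
  obtain ⟨B, m', hB, hGB, hBm⟩ :=
    h.exists_respondsAt_written (p₂ := ⟨1, by omega⟩) le_rfl (by simp)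
  exact not_stronglyLinearizable_of_fork ⟨s, h.run⟩ hA hB hGA hGB h.invoked h.complete hAm hv₀ hBm
    (by simpa using hv)

end NotStrong

end VectorClock

end RegisterLin

theorem mainTheorem8 {V : Type*} [Nontrivial V] (v₀ : V) (n : ℕ) (hn : 3 ≤ n) :
    -- the algorithm is not strongly linearizable
    ¬ RegisterLin.StronglyLinearizable v₀ (RegisterLin.VectorClock.histories n v₀) ∧
    -- strong linearizability implies write strong-linearizability, and this is strict:
    -- the algorithm is write strongly-linearizable
    (∀ ℋ : Set (RegisterLin.History n V),
      RegisterLin.StronglyLinearizable v₀ ℋ → RegisterLin.WriteStronglyLinearizable v₀ ℋ) ∧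
    RegisterLin.WriteStronglyLinearizable v₀ (RegisterLin.VectorClock.histories n v₀) :=
  ⟨RegisterLin.VectorClock.not_stronglyLinearizable_histories v₀ hn,
    fun _ h => h.writeStronglyLinearizable,
    RegisterLin.VectorClock.writeStronglyLinearizable_histories v₀ (by omega)⟩
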